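/- Let $\mathsf{HA}$ be intuitionistic first-order arithmetic in the language with equality, function symbols for all primitive recursive functions, and the logical constants $\forall,\exists,\to,\land,\lor,\perp$ (with $\neg\varphi$ meaning $\varphi\to\perp$), and let $\mathsf{PA}$ be $\mathsf{HA}$ plus the law of excluded middle. $\Sigma_0=\Pi_0$ is the class of quantifier-free formulas; $\Sigma_{k+1}$ (resp. $\Pi_{k+1}$) is the class of formulas $\exists x_1\cdots\exists x_n\,\psi$ with $n\ge 1$ and $\psi\in\Pi_k$ (resp. $\forall x_1\cdots\forall x_n\,\psi$ with $n\ge 1$ and $\psi\in\Sigma_k$). The set $\mathrm{Alt}(\varphi)$ of alternation paths of $\varphi$ is a set of finite sequences of signs $+,-$, defined as follows, where $s^\perp$ is $s$ with all signs switched. If $\varphi$ is quantifier-free, $\mathrm{Alt}(\varphi)=\{\langle\,\rangle\}$. Otherwise $\mathrm{Alt}(\neg\varphi_1)=\{s^\perp: s\in \mathrm{Alt}(\varphi_1)\}$; $\mathrm{Alt}(\varphi_1\land\varphi_2)=\mathrm{Alt}(\varphi_1\lor\varphi_2)=\mathrm{Alt}(\varphi_1)\cup\mathrm{Alt}(\varphi_2)$;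 $\mathrm{Alt}(\varphi_1\to\varphi_2)=\{s^\perp: s\in\mathrm{Alt}(\varphi_1)\}\cup\mathrm{Alt}(\varphi_2)$ (if $\varphi_2$ is not $\perp$); $\mathrm{Alt}(\forall x\,\varphi_1)$ (resp. $\mathrm{Alt}(\exists x\,\varphi_1)$) is obtained from $\mathrm{Alt}(\varphi_1)$ by prefixing $-$ (resp. $+$) to each path that does not already begin with that sign. Let $\mathrm{F}_k$ be the class of formulas whose longest alternation path has length $k$; $\mathrm{U}_0=\mathrm{E}_0=\mathrm{F}_0$; and for $k\ge 1$ let $\mathrm{U}_k$ (resp. $\mathrm{E}_k$) be the class of $\varphi\in\mathrm{F}_k$ all of whose alternation paths of length $k$ begin with $-$ (resp. $+$). For a class $\Gamma$ of formulas, $\neg\Gamma=\{\neg\varphi:\varphi\in\Gamma\}$, $\neg\neg\Gamma=\{\neg\neg\varphi:\varphi\in\Gamma\}$, and $\Gamma^{\mathrm{df}}$ is the class of formulas in $\Gamma$ that do not contain $\lor$. The schema $\neg\neg\Gamma\text{-}\mathrm{LEM}$ (resp. $\neg\neg\Gamma\text{-}\mathrm{DNE}$) consists of the sentences $\neg\neg\forall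 x(\varphi(x)\lor\neg\varphi(x))$ (resp. $\neg\neg\forall x(\neg\neg\varphi(x)\to\varphi(x))$), where $\varphi\in\Gamma$ has no free variable other than $x$. A theory proves a schema if it proves all of its instances. For a theory $T$ and classes $\Gamma,\Gamma'$, let $\mathrm{PNFT}_T(\Gamma,\Gamma')$ say that for each $\varphi\in\Gamma$ there is $\varphi'\in\Gamma'$ with the same free variables such that $T\vdash\varphi\leftrightarrow\varphi'$. **Theorem.** Let $k$ be a natural number and let $T$ be a theory in the language of $\mathsf{HA}$, closed under intuitionistic first-order logic, that contains $\mathsf{HA}+\neg\neg\Pi_{k-2}\text{-}\mathrm{LEM}$ ($\mathsf{HA}$ if $k<2$) and is contained in $\mathsf{PA}$. Then the following are pairwise equivalent: 1. $\mathrm{PNFT}_T\big((\neg\mathrm{E}_{k'})^{\mathrm{df}},\ \neg\neg\Pi_{k'}\big)$ for all $k'\le k$; 2. $\mathrm{PNFT}_T\big((\neg\neg\mathrm{U}_{k'})^{\mathrm{df}},\ \neg\neg\Pi_{k'}\big)$ for all $k'\le k$; 3. $T\vdash\neg\neg\Sigma_{k-1}\text{-}\mathrm{DNE}$ (a condition that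 is regarded as vacuously true if $k=0$). -/

import Mathlib

namespace HeytingArith

open FirstOrder

/-! ### The language: one function symbol for each description of a primitive recursive function -/

/-- Descriptions of `n`-ary primitive recursive functions. In `prec f g` the recursion runs on the
first argument: `h(0, v) = f(v)` and `h(y + 1, v) = g(y, h(y, v), v)`. -/
inductive PRSymb : ℕ → Type
  | zero : PRSymb 0
  | succ : PRSymb 1
  | proj {n : ℕ} (i : Fin n) : PRSymb n
  | comp {m n : ℕ} (f : PRSymb n) (g : Fin n → PRSymb m) : PRSymb m
  | prec {n : ℕ} (f : PRSymb n) (g : PRSymb (n + 2)) : PRSymb (n + 1)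

/-- The language of arithmetic; its only relation symbol is equality, which is a primitive of the
formulas below. -/
def arithLang : Language := ⟨PRSymb, fun _ => Empty⟩

/-- Terms; the variables are de Bruijn indices. -/
abbrev Tm : Type := arithLang.Term ℕ

def mkApp {n : ℕ} (f : PRSymb n) (v : Fin n → Tm) : Tm := Language.Term.func (L := arithLang) f v

def zeroT : Tm := mkApp PRSymb.zero ![]

def succT (t : Tm) : Tm := mkApp PRSymb.succ ![t]

/-- Formulas, up to renaming of bound variables: under a quantifier the index `0` is the bound
variable and `n + 1` is the variable that is called `n` outside. -/
inductive Fml : Type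
  | bot : Fml
  | eq (t u : Tm) : Fml
  | and (φ ψ : Fml) : Fml
  | or (φ ψ : Fml) : Fml
  | imp (φ ψ : Fml) : Fml
  | all (φ : Fml) : Fml
  | ex (φ : Fml) : Fml

/-- Passing a substitution under a quantifier. -/
def liftSubst (σ : ℕ → Tm) : ℕ → Tm
  | 0 => Language.Term.var 0
  | n + 1 => (σ n).relabel Nat.succ

namespace Fml

def neg (φ : Fml) : Fml := φ.imp bot

def iff (φ ψ : Fml) : Fml := (φ.imp ψ).and (ψ.imp φ)

/-- Simultaneous (capture-avoiding) substitution of `σ n` for each free variable `n`. -/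
def subst : Fml → (ℕ → Tm) → Fml
  | bot, _ => bot
  | eq t u, σ => eq (t.subst σ) (u.subst σ)
  | and φ ψ, σ => and (φ.subst σ) (ψ.subst σ)
  | or φ ψ, σ => or (φ.subst σ) (ψ.subst σ)
  | imp φ ψ, σ => imp (φ.subst σ) (ψ.subst σ)
  | all φ, σ => all (φ.subst (liftSubst σ))
  | ex φ, σ => ex (φ.subst (liftSubst σ))

/-- Rename each free variable `n` to `n + 1`, so that `0` becomes fresh. -/
def shift (φ : Fml) : Fml := φ.subst fun n => Language.Term.var (n + 1)

/-- `φ(t)`, for `φ` the body of a quantifier. -/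
def inst (φ : Fml) (t : Tm) : Fml :=
  φ.subst fun n => Nat.casesOn n t Language.Term.var

/-- `φ(S x)`, for `φ = φ(x)` the body of a quantifier that binds `x`. -/
def instSucc (φ : Fml) : Fml :=
  φ.subst fun n => Nat.casesOn n (succT (Language.Term.var 0)) fun m => Language.Term.var (m + 1)

/-- The set of free variables. -/
def fv : Fml → Set ℕ
  | bot => ∅
  | eq t u => ↑(t.varFinset ∪ u.varFinset)
  | and φ ψ => φ.fv ∪ ψ.fv
  | or φ ψ => φ.fv ∪ ψ.fv
  | imp φ ψ => φ.fv ∪ ψ.fv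
  | all φ => {n | n + 1 ∈ φ.fv}
  | ex φ => {n | n + 1 ∈ φ.fv}

/-- Quantifier-free formulas. -/
def IsQF : Fml → Prop
  | bot => True
  | eq _ _ => True
  | and φ ψ => φ.IsQF ∧ ψ.IsQF
  | or φ ψ => φ.IsQF ∧ ψ.IsQF
  | imp φ ψ => φ.IsQF ∧ ψ.IsQF
  | all _ => False
  | ex _ => False

/-- Formulas that do not contain `∨`. -/
def OrFree : Fml → Prop
  | bot => True
  | eq _ _ => True
  | and φ ψ => φ.OrFree ∧ ψ.OrFree
  | or _ _ => False
  | imp φ ψ => φ.OrFree ∧ ψ.OrFree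
  | all φ => φ.OrFree
  | ex φ => φ.OrFree

end Fml

/-! ### Intuitionistic first-order logic and theories -/

/-- Natural deduction for intuitionistic first-order logic: `Derives T Γ φ` says that `φ` is
derivable from the assumptions `Γ` and the nonlogical axioms `T`. An axiom with free variables
stands for its universal closure, since it may be used in every context. -/
inductive Derives (T : Set Fml) : List Fml → Fml → Prop
  | ax {Γ : List Fml} {φ : Fml} : φ ∈ T → Derives T Γ φ
  | hyp {Γ : List Fml} {φ : Fml} : φ ∈ Γ → Derives T Γ φ
  | botE {Γ : List Fml} {φ : Fml} : Derives T Γ .bot → Derives T Γ φ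
  | andI {Γ : List Fml} {φ ψ : Fml} : Derives T Γ φ → Derives T Γ ψ → Derives T Γ (φ.and ψ)
  | andEl {Γ : List Fml} {φ ψ : Fml} : Derives T Γ (φ.and ψ) → Derives T Γ φ
  | andEr {Γ : List Fml} {φ ψ : Fml} : Derives T Γ (φ.and ψ) → Derives T Γ ψ
  | orIl {Γ : List Fml} {φ ψ : Fml} : Derives T Γ φ → Derives T Γ (φ.or ψ)
  | orIr {Γ : List Fml} {φ ψ : Fml} : Derives T Γ ψ → Derives T Γ (φ.or ψ)
  | orE {Γ : List Fml} {φ ψ χ : Fml} : Derives T Γ (φ.or ψ) → Derives T (φ :: Γ) χ →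
      Derives T (ψ :: Γ) χ → Derives T Γ χ
  | impI {Γ : List Fml} {φ ψ : Fml} : Derives T (φ :: Γ) ψ → Derives T Γ (φ.imp ψ)
  | impE {Γ : List Fml} {φ ψ : Fml} : Derives T Γ (φ.imp ψ) → Derives T Γ φ → Derives T Γ ψ
  | allI {Γ : List Fml} {φ : Fml} : Derives T (Γ.map Fml.shift) φ → Derives T Γ φ.all
  | allE {Γ : List Fml} {φ : Fml} (t : Tm) : Derives T Γ φ.all → Derives T Γ (φ.inst t)
  | exI {Γ : List Fml} {φ : Fml} (t : Tm) : Derives T Γ (φ.inst t) → Derives T Γ φ.ex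
  | exE {Γ : List Fml} {φ ψ : Fml} : Derives T Γ φ.ex →
      Derives T (φ :: Γ.map Fml.shift) ψ.shift → Derives T Γ ψ

/-- `T ⊢ φ` -/
def Proves (T : Set Fml) (φ : Fml) : Prop := Derives T [] φ

/-- `T ⊢ P` for a schema `P`, given as the set of its instances. -/
def ProvesSchema (T P : Set Fml) : Prop := ∀ φ ∈ P, Proves T φ

/-- `T` is an extension of `S`: every theorem of `S` is a theorem of `T`. -/
def IsExtension (T S : Set Fml) : Prop := ∀ φ : Fml, Proves S φ → Proves T φ

/-! ### Intuitionistic and classical arithmetic -/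

/-- The axioms of intuitionistic arithmetic: equality, the successor axioms, the defining
equations of the primitive recursive functions, and induction for all formulas. -/
inductive HA : Set Fml
  | eqRefl (t : Tm) : HA (.eq t t)
  | eqEucl (t u r : Tm) : HA ((Fml.eq t u).imp ((Fml.eq t r).imp (.eq u r)))
  | eqCongr {n : ℕ} (f : PRSymb n) (v : Fin n → Tm) (i : Fin n) (t u : Tm) :
      HA ((Fml.eq t u).imp
        (.eq (mkApp f (Function.update v i t)) (mkApp f (Function.update v i u))))
  | succNeZero (t : Tm) : HA (Fml.eq (succT t) zeroT).neg
  | succInj (t u : Tm) : HA ((Fml.eq (succT t) (succT u)).imp (.eq t u))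
  | projEq {n : ℕ} (i : Fin n) (v : Fin n → Tm) : HA (.eq (mkApp (.proj i) v) (v i))
  | compEq {m n : ℕ} (f : PRSymb n) (g : Fin n → PRSymb m) (v : Fin m → Tm) :
      HA (.eq (mkApp (.comp f g) v) (mkApp f fun i => mkApp (g i) v))
  | precZero {n : ℕ} (f : PRSymb n) (g : PRSymb (n + 2)) (v : Fin n → Tm) :
      HA (.eq (mkApp (.prec f g) (Matrix.vecCons zeroT v)) (mkApp f v))
  | precSucc {n : ℕ} (f : PRSymb n) (g : PRSymb (n + 2)) (t : Tm) (v : Fin n → Tm) :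
      HA (.eq (mkApp (.prec f g) (Matrix.vecCons (succT t) v))
        (mkApp g (Matrix.vecCons t
          (Matrix.vecCons (mkApp (.prec f g) (Matrix.vecCons t v)) v))))
  | induction (φ : Fml) :
      HA ((φ.inst zeroT).imp ((φ.imp φ.instSucc).all.imp φ.all))

/-- Classical arithmetic: all instances of the law of excluded middle are added. -/
def PA : Set Fml := HA ∪ {ξ | ∃ φ : Fml, ξ = φ.or φ.neg}

/-! ### The prenex classes -/

mutual

/-- `Σ_k`, with a nonempty list of quantifiers of the same kind in each of the `k` blocks. -/
def SigmaClass : ℕ → Set Fml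
  | 0 => {φ | φ.IsQF}
  | k + 1 => {φ | ∃ n : ℕ, ∃ ψ ∈ PiClass k, φ = Fml.ex^[n + 1] ψ}

/-- `Π_k`, likewise. -/
def PiClass : ℕ → Set Fml
  | 0 => {φ | φ.IsQF}
  | k + 1 => {φ | ∃ n : ℕ, ∃ ψ ∈ SigmaClass k, φ = Fml.all^[n + 1] ψ}

end

/-! ### Logical principles -/

/-- `Γ-LEM`: `∀ x, φ(x) ∨ ¬ φ(x)` for `φ ∈ Γ` with no free variable other than `x`. -/
def LEM (Γ : Set Fml) : Set Fml := {ξ | ∃ φ ∈ Γ, φ.fv ⊆ {0} ∧ ξ = (φ.or φ.neg).all}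

/-- `Γ-DNE`: `∀ x, ¬ ¬ φ(x) → φ(x)` for `φ ∈ Γ` with no free variable other than `x`. -/
def DNE (Γ : Set Fml) : Set Fml := {ξ | ∃ φ ∈ Γ, φ.fv ⊆ {0} ∧ ξ = (φ.neg.neg.imp φ).all}

/-- The class of the formulas `¬ φ` with `φ ∈ Γ`. -/
def negClass (Γ : Set Fml) : Set Fml := {ξ | ∃ φ ∈ Γ, ξ = φ.neg}

/-- The class (or schema) of the formulas `¬ ¬ φ` with `φ ∈ Γ`. -/
def dnClass (Γ : Set Fml) : Set Fml := {ξ | ∃ φ ∈ Γ, ξ = φ.neg.neg}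

/-- The formulas of `Γ` that do not contain `∨`. -/
def dfClass (Γ : Set Fml) : Set Fml := {φ | φ ∈ Γ ∧ φ.OrFree}

/-! ### Alternation paths and the classes `F_k`, `U_k`, `E_k` -/

/-- Alternation paths are lists of signs: `true` is `+`, `false` is `-`. This is `s ↦ s^⊥`. -/
def perp (s : List Bool) : List Bool := s.map not

/-- Prefix the sign `b` to `s`, unless `s` starts with `b`. -/
def pushSign (b : Bool) (s : List Bool) : List Bool := if s.head? = some b then s else b :: s

/-- The set of alternation paths of a formula. (It is `{⟨⟩}` if the formula is quantifier-free:
see `alt_of_isQF`.) -/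
def alt : Fml → Finset (List Bool)
  | .bot => {[]}
  | .eq _ _ => {[]}
  | .and φ ψ => alt φ ∪ alt ψ
  | .or φ ψ => alt φ ∪ alt ψ
  | .imp φ .bot => (alt φ).image perp
  | .imp φ ψ => (alt φ).image perp ∪ alt ψ
  | .all φ => (alt φ).image (pushSign false)
  | .ex φ => (alt φ).image (pushSign true)

theorem alt_neg (φ : Fml) : alt φ.neg = (alt φ).image perp := by
  simp [Fml.neg, alt]

theorem alt_of_isQF (φ : Fml) (h : φ.IsQF) : alt φ = {[]} := by
  induction φ with
  | bot => simp [alt]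
  | eq t u => simp [alt]
  | and φ ψ ih₁ ih₂ => simp [alt, ih₁ h.1, ih₂ h.2]
  | or φ ψ ih₁ ih₂ => simp [alt, ih₁ h.1, ih₂ h.2]
  | imp φ ψ ih₁ ih₂ =>
    have h₁ := ih₁ h.1
    have h₂ := ih₂ h.2
    cases ψ <;> simp_all [alt, perp]
  | all φ => exact h.elim
  | ex φ => exact h.elim

/-- The maximal length of an alternation path. -/
def degree (φ : Fml) : ℕ := (alt φ).sup List.length

def FClass (k : ℕ) : Set Fml := {φ | degree φ = k}

def UClass : ℕ → Set Fml
  | 0 => FClass 0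
  | k + 1 => {φ | φ ∈ FClass (k + 1) ∧ ∀ s ∈ alt φ, s.length = k + 1 → s.head? = some false}

def EClass : ℕ → Set Fml
  | 0 => FClass 0
  | k + 1 => {φ | φ ∈ FClass (k + 1) ∧ ∀ s ∈ alt φ, s.length = k + 1 → s.head? = some true}

/-- The prenex normal form theorem for `Γ` and `Δ` over `T`: each `φ ∈ Γ` is `T`-equivalent to
some `ψ ∈ Δ` with the same free variables. -/
def PNFT (T Γ Δ : Set Fml) : Prop :=
  ∀ φ ∈ Γ, ∃ ψ ∈ Δ, φ.fv = ψ.fv ∧ Proves T (φ.iff ψ)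

end HeytingArith

open HeytingArith

-- The implication from 1 to 2 is an inclusion of classes: the negation of a `U_j` formula is an
-- `E_j` formula.
--
-- From 3 to 1, put m = k - 1 (m = 0 if k = 0) and argue in `HA` + `Σ_m-DNE`. There `Σ_j` formulas
-- with j ≤ m are stable (`¬¬φ → φ`), and hence so are `Π_j` formulas with j ≤ m + 1. Consequently
-- negation exchanges `Σ_j` and `Π_j` (from `Π_j` to `Σ_j` only for j ≤ m), and `Π_j` with j ≤ m + 1
-- is closed under `¬¬(φ ∨ χ)` (`RPi.dn_or`). An implication with stable conclusion is `¬¬(¬φ ∨ χ)`,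
-- so formulas without disjunction can be put in prenex form by recursion on their structure, with
-- the alternation paths counting quantifier blocks (`rep_of_altLe`). At level m + 1 stability of
-- `Σ` formulas is lost; there the recursion follows `¬φ` instead of φ on the existential side
-- (`rep_of_altLe_succ`). This gives `¬φ ↔ ψ` with ψ in `Π_j` for φ in `E_j`. Since `T` proves the
-- double negation of every axiom used, it proves `¬¬(¬φ ↔ ψ)`, which yields `¬φ ↔ ¬¬ψ`.
--
-- From 2 to 3, `Σ_i-DNE` is climbed by induction on i. For φ in `Σ_{a+1}` without disjunction, the
-- sentence `∀x (¬¬φ → φ)` lies in `U_{a+2}`, so by 2 its double negation is `T`-equivalent to `¬¬π`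
-- with π in `Π_{a+2}`. As `T` is contained in `PA`, `PA` proves π. Now `PA` is
-- `Π_{a+2}`-conservative over `HA` + `Π_a-LEM` + `Σ_a-DNE` (`proves_pi_of_PA`), and `T` proves the
-- double negations of these axioms: of `Π_a-LEM` by hypothesis, of `Σ_a-DNE` by induction. So `T`
-- proves `¬¬π`.
--
-- The conservation result is Friedman's trick. The negative translation with `⊥` replaced by a
-- formula R sends theorems of `PA` to theorems of `HA`; for φ in `Σ_{m+1}` the translation is
-- equivalent to `(φ → R) → R` by `Π_m-LEM` and `Σ_m-DNE`, and R := φ gives back φ.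

namespace HeytingArith

open FirstOrder

/-! ### Substitution calculus -/

/-- Composition of substitutions. -/
def scomp (σ τ : ℕ → Tm) : ℕ → Tm := fun n => (σ n).subst τ

/-- Extend a substitution by a value at the index `0`. -/
def scons (t : Tm) (σ : ℕ → Tm) : ℕ → Tm
  | 0 => t
  | n + 1 => σ n

/-- The identity substitution. -/
def sid : ℕ → Tm := Language.Term.var

/-- The substitution that makes the index `0` fresh. -/
def sshift : ℕ → Tm := fun n => Language.Term.var (n + 1)

@[simp] theorem scons_zero (t : Tm) (σ : ℕ → Tm) : scons t σ 0 = t := rfl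
@[simp] theorem scons_succ (t : Tm) (σ : ℕ → Tm) (n : ℕ) : scons t σ (n + 1) = σ n := rfl
@[simp] theorem sid_apply (n : ℕ) : sid n = Language.Term.var n := rfl
@[simp] theorem sshift_apply (n : ℕ) : sshift n = Language.Term.var (n + 1) := rfl
theorem scomp_apply (σ τ : ℕ → Tm) (n : ℕ) : scomp σ τ n = (σ n).subst τ := rfl

@[simp] theorem Tm.subst_subst (t : Tm) (σ τ : ℕ → Tm) :
    (t.subst σ).subst τ = t.subst (scomp σ τ) := by
  induction t with
  | var => rfl
  | func f ts ih => simp [ih]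

@[simp] theorem Tm.subst_sid (t : Tm) : t.subst sid = t := by
  induction t with
  | var => rfl
  | func f ts ih => simp [ih]

theorem Tm.relabel_succ (t : Tm) : t.relabel Nat.succ = t.subst sshift := by
  induction t with
  | var => rfl
  | func f ts ih => simp [ih]

@[simp] theorem scomp_assoc (σ τ ρ : ℕ → Tm) : scomp (scomp σ τ) ρ = scomp σ (scomp τ ρ) := by
  funext n; simp [scomp]

@[simp] theorem scomp_scons (t : Tm) (σ τ : ℕ → Tm) :
    scomp (scons t σ) τ = scons (t.subst τ) (scomp σ τ) := by
  funext n; cases n <;> rfl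

@[simp] theorem sshift_scomp_scons (t : Tm) (σ : ℕ → Tm) : scomp sshift (scons t σ) = σ := rfl
@[simp] theorem sid_scomp (σ : ℕ → Tm) : scomp sid σ = σ := rfl
@[simp] theorem scomp_sid (σ : ℕ → Tm) : scomp σ sid = σ := by funext n; simp [scomp]
@[simp] theorem scons_var_sshift : scons (Language.Term.var 0) sshift = sid := by
  funext n; cases n <;> rfl

theorem liftSubst_eq (σ : ℕ → Tm) :
    liftSubst σ = scons (Language.Term.var 0) (scomp σ sshift) := by
  funext n
  cases n with
  | zero => rfl
  | succ n => exact Tm.relabel_succ _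

@[simp] theorem mkApp_subst {n : ℕ} (f : PRSymb n) (v : Fin n → Tm) (σ : ℕ → Tm) :
    (mkApp f v).subst σ = mkApp f fun i => (v i).subst σ := rfl

@[simp] theorem zeroT_subst (σ : ℕ → Tm) : zeroT.subst σ = zeroT := by
  simp only [zeroT, mkApp_subst]
  congr 1
  funext i
  exact i.elim0

@[simp] theorem succT_subst (t : Tm) (σ : ℕ → Tm) : (succT t).subst σ = succT (t.subst σ) := by
  simp only [succT, mkApp_subst]
  congr 1
  funext i
  fin_cases i
  rfl

namespace Fml

theorem shift_eq (φ : Fml) : φ.shift = φ.subst sshift := rfl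

theorem inst_eq (φ : Fml) (t : Tm) : φ.inst t = φ.subst (scons t sid) := by
  unfold inst
  congr 1
  funext n
  cases n <;> rfl

theorem instSucc_eq (φ : Fml) :
    φ.instSucc = φ.subst (scons (succT (Language.Term.var 0)) sshift) := by
  unfold instSucc
  congr 1
  funext n
  cases n <;> rfl

@[simp] theorem subst_subst (φ : Fml) (σ τ : ℕ → Tm) :
    (φ.subst σ).subst τ = φ.subst (scomp σ τ) := by
  induction φ generalizing σ τ <;> simp_all [subst, liftSubst_eq]

@[simp] theorem subst_sid (φ : Fml) : φ.subst sid = φ := by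
  induction φ <;> simp_all [subst, liftSubst_eq]

theorem inst_subst_eq (φ : Fml) (t : Tm) (σ : ℕ → Tm) :
    (φ.inst t).subst σ = φ.subst (scons (t.subst σ) σ) := by
  simp [inst_eq]

@[simp] theorem subst_liftSubst_inst (φ : Fml) (t : Tm) (σ : ℕ → Tm) :
    (φ.subst (liftSubst σ)).inst t = φ.subst (scons t σ) := by
  simp [inst_eq, liftSubst_eq]

@[simp] theorem shift_inst (φ : Fml) (t : Tm) : φ.shift.inst t = φ := by
  simp [inst_eq, shift_eq]

theorem shift_subst_liftSubst (φ : Fml) (σ : ℕ → Tm) :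
    φ.shift.subst (liftSubst σ) = (φ.subst σ).shift := by
  simp [shift_eq, liftSubst_eq]

@[simp] theorem shift_subst_scons (φ : Fml) (t : Tm) (σ : ℕ → Tm) :
    φ.shift.subst (scons t σ) = φ.subst σ := by
  simp [shift_eq]

@[simp] theorem inst_and (φ ψ : Fml) (t : Tm) : (φ.and ψ).inst t = (φ.inst t).and (ψ.inst t) := rfl
@[simp] theorem inst_or (φ ψ : Fml) (t : Tm) : (φ.or ψ).inst t = (φ.inst t).or (ψ.inst t) := rfl
@[simp] theorem inst_imp (φ ψ : Fml) (t : Tm) : (φ.imp ψ).inst t = (φ.inst t).imp (ψ.inst t) := rfl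
@[simp] theorem inst_neg (φ : Fml) (t : Tm) : φ.neg.inst t = (φ.inst t).neg := rfl
@[simp] theorem subst_neg (φ : Fml) (σ : ℕ → Tm) : φ.neg.subst σ = (φ.subst σ).neg := rfl

/-! ### Free variables -/

theorem mem_fv_eq {t u : Tm} {n : ℕ} :
    n ∈ (eq t u).fv ↔ n ∈ t.varFinset ∨ n ∈ u.varFinset := by
  simp [fv]

end Fml

theorem Tm.subst_congr {t : Tm} {σ τ : ℕ → Tm} (h : ∀ n ∈ t.varFinset, σ n = τ n) :
    t.subst σ = t.subst τ := by
  induction t with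
  | var n => exact h n (by simp)
  | func f ts ih =>
    simp only [Language.Term.subst]
    congr 1
    funext i
    exact ih i fun n hn => h n (Finset.mem_biUnion.2 ⟨i, Finset.mem_univ _, hn⟩)

theorem Tm.mem_varFinset_subst {t : Tm} {σ : ℕ → Tm} {n : ℕ} :
    n ∈ (t.subst σ).varFinset ↔ ∃ m ∈ t.varFinset, n ∈ (σ m).varFinset := by
  induction t with
  | var k => simp
  | func f ts ih =>
    simp only [Language.Term.subst, Language.Term.varFinset, Finset.mem_biUnion, ih]
    constructor
    · rintro ⟨i, hi, m, hm, hn⟩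
      exact ⟨m, ⟨i, hi, hm⟩, hn⟩
    · rintro ⟨m, ⟨i, hi, hm⟩, hn⟩
      exact ⟨i, hi, m, hm, hn⟩

namespace Fml

theorem subst_congr {φ : Fml} {σ τ : ℕ → Tm} (h : ∀ n ∈ φ.fv, σ n = τ n) :
    φ.subst σ = φ.subst τ := by
  induction φ generalizing σ τ with
  | bot => rfl
  | eq t u =>
    simp only [subst]
    rw [Tm.subst_congr fun n hn => h n (mem_fv_eq.2 (.inl hn)),
      Tm.subst_congr fun n hn => h n (mem_fv_eq.2 (.inr hn))]
  | and φ ψ h₁ h₂ | or φ ψ h₁ h₂ | imp φ ψ h₁ h₂ =>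
    simp only [subst]
    rw [h₁ fun n hn => h n (.inl hn), h₂ fun n hn => h n (.inr hn)]
  | all φ ih | ex φ ih =>
    simp only [subst]
    rw [ih]
    intro n hn
    cases n with
    | zero => rfl
    | succ n => simp only [liftSubst]; rw [h n hn]

theorem mem_fv_subst {φ : Fml} {σ : ℕ → Tm} {n : ℕ} :
    n ∈ (φ.subst σ).fv ↔ ∃ m ∈ φ.fv, n ∈ (σ m).varFinset := by
  induction φ generalizing σ n with
  | bot => simp [subst, fv]
  | eq t u =>
    simp only [subst, mem_fv_eq, Tm.mem_varFinset_subst]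
    grind
  | and φ ψ h₁ h₂ | or φ ψ h₁ h₂ | imp φ ψ h₁ h₂ =>
    simp only [subst, fv, Set.mem_union, h₁, h₂]
    grind
  | all φ ih | ex φ ih =>
    simp only [subst, fv, Set.mem_ofPred_eq, ih, liftSubst_eq]
    constructor
    · rintro ⟨m, hm, hn⟩
      cases m with
      | zero => simp at hn
      | succ m =>
        simp only [scons_succ, scomp_apply, Tm.mem_varFinset_subst] at hn
        obtain ⟨k, hk, hk'⟩ := hn
        simp at hk'
        exact ⟨m, hm, hk' ▸ hk⟩
    · rintro ⟨m, hm, hn⟩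
      refine ⟨m + 1, hm, ?_⟩
      simp only [scons_succ, scomp_apply, Tm.mem_varFinset_subst]
      exact ⟨n, hn, by simp⟩

@[simp] theorem succ_mem_fv_shift {φ : Fml} {n : ℕ} : n + 1 ∈ φ.shift.fv ↔ n ∈ φ.fv := by
  simp [shift_eq, mem_fv_subst]

theorem subst_eq_self {φ : Fml} (h : φ.fv = ∅) (σ : ℕ → Tm) : φ.subst σ = φ := by
  conv_rhs => rw [← subst_sid φ]
  exact subst_congr (by simp [h])

theorem fv_bddAbove (φ : Fml) : ∃ N, ∀ n ∈ φ.fv, n < N := by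
  induction φ with
  | bot => exact ⟨0, by simp [fv]⟩
  | eq t u =>
    refine ⟨(t.varFinset ∪ u.varFinset).sup id + 1, fun n hn => ?_⟩
    exact Nat.lt_succ_of_le (Finset.le_sup (f := id) (by simpa [fv] using hn))
  | and φ ψ h₁ h₂ | or φ ψ h₁ h₂ | imp φ ψ h₁ h₂ =>
    obtain ⟨a, ha⟩ := h₁
    obtain ⟨b, hb⟩ := h₂
    refine ⟨max a b, fun n hn => ?_⟩
    rcases hn with hn | hn
    · exact lt_max_of_lt_left (ha n hn)
    · exact lt_max_of_lt_right (hb n hn)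
  | all φ ih | ex φ ih =>
    obtain ⟨a, ha⟩ := ih
    exact ⟨a, fun n hn => by have := ha _ hn; omega⟩

end Fml

/-! ### Structural properties of derivations -/

theorem Derives.weaken {T : Set Fml} {Γ Δ : List Fml} {φ : Fml} (h : Derives T Γ φ) (hs : Γ ⊆ Δ) :
    Derives T Δ φ := by
  induction h generalizing Δ with
  | ax h => exact .ax h
  | hyp h => exact .hyp (hs h)
  | botE _ ih => exact .botE (ih hs)
  | andI _ _ h₁ h₂ => exact .andI (h₁ hs) (h₂ hs)
  | andEl _ ih => exact .andEl (ih hs)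
  | andEr _ ih => exact .andEr (ih hs)
  | orIl _ ih => exact .orIl (ih hs)
  | orIr _ ih => exact .orIr (ih hs)
  | orE _ _ _ h₁ h₂ h₃ =>
    exact .orE (h₁ hs) (h₂ (List.cons_subset_cons _ hs)) (h₃ (List.cons_subset_cons _ hs))
  | impI _ ih => exact .impI (ih (List.cons_subset_cons _ hs))
  | impE _ _ h₁ h₂ => exact .impE (h₁ hs) (h₂ hs)
  | allI _ ih => exact .allI (ih (List.map_subset _ hs))
  | allE t _ ih => exact .allE t (ih hs)
  | exI t _ ih => exact .exI t (ih hs)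
  | exE _ _ h₁ h₂ => exact .exE (h₁ hs) (h₂ (List.cons_subset_cons _ (List.map_subset _ hs)))

/-- Replace the nonlogical axioms by theorems of another theory. -/
theorem Derives.trans_theory {T S : Set Fml} {Γ : List Fml} {φ : Fml} (h : Derives S Γ φ)
    (hs : ∀ χ ∈ S, Proves T χ) : Derives T Γ φ := by
  induction h with
  | ax h => exact (hs _ h).weaken (List.nil_subset _)
  | hyp h => exact .hyp h
  | botE _ ih => exact .botE ih
  | andI _ _ h₁ h₂ => exact .andI h₁ h₂
  | andEl _ ih => exact .andEl ih
  | andEr _ ih => exact .andEr ih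
  | orIl _ ih => exact .orIl ih
  | orIr _ ih => exact .orIr ih
  | orE _ _ _ h₁ h₂ h₃ => exact .orE h₁ h₂ h₃
  | impI _ ih => exact .impI ih
  | impE _ _ h₁ h₂ => exact .impE h₁ h₂
  | allI _ ih => exact .allI ih
  | allE t _ ih => exact .allE t ih
  | exI t _ ih => exact .exI t ih
  | exE _ _ h₁ h₂ => exact .exE h₁ h₂

theorem Derives.mono {T S : Set Fml} {Γ : List Fml} {φ : Fml} (h : Derives S Γ φ) (hs : S ⊆ T) :
    Derives T Γ φ :=
  h.trans_theory fun _ hχ => .ax (hs hχ)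

/-- The set of axioms is closed under substitution. -/
def SubstClosed (T : Set Fml) : Prop := ∀ φ ∈ T, ∀ σ, φ.subst σ ∈ T

theorem map_shift_map_subst (Γ : List Fml) (σ : ℕ → Tm) :
    (Γ.map Fml.shift).map (·.subst (liftSubst σ)) = (Γ.map (·.subst σ)).map Fml.shift := by
  simp [Fml.shift_subst_liftSubst]

theorem Derives.subst {T : Set Fml} (hT : SubstClosed T) {Γ : List Fml} {φ : Fml}
    (h : Derives T Γ φ) (σ : ℕ → Tm) : Derives T (Γ.map (·.subst σ)) (φ.subst σ) := by
  induction h generalizing σ with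
  | ax h => exact .ax (hT _ h σ)
  | hyp h => exact .hyp (List.mem_map_of_mem h)
  | botE _ ih => exact .botE (ih σ)
  | andI _ _ h₁ h₂ => exact .andI (h₁ σ) (h₂ σ)
  | andEl _ ih => exact .andEl (ih σ)
  | andEr _ ih => exact .andEr (ih σ)
  | orIl _ ih => exact .orIl (ih σ)
  | orIr _ ih => exact .orIr (ih σ)
  | orE _ _ _ h₁ h₂ h₃ => exact .orE (h₁ σ) (h₂ σ) (h₃ σ)
  | impI _ ih => exact .impI (ih σ)
  | impE _ _ h₁ h₂ => exact .impE (h₁ σ) (h₂ σ)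
  | allI _ ih =>
    refine .allI ?_
    rw [← map_shift_map_subst]
    exact ih _
  | @allE _ φ t _ ih =>
    rw [Fml.inst_subst_eq, ← Fml.subst_liftSubst_inst]
    exact .allE _ (ih σ)
  | exI t _ ih =>
    refine .exI (t.subst σ) ?_
    rw [Fml.subst_liftSubst_inst, ← Fml.inst_subst_eq]
    exact ih σ
  | exE _ _ h₁ h₂ =>
    refine .exE (h₁ σ) ?_
    rw [← map_shift_map_subst, ← Fml.shift_subst_liftSubst]
    exact h₂ _

/-- A variable that is fresh for a formula and a context. -/
theorem exists_fresh (Γ : List Fml) : ∃ n, ∀ φ ∈ Γ, ∀ m ∈ φ.fv, m < n := by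
  induction Γ with
  | nil => exact ⟨0, by simp⟩
  | cons φ Γ ih =>
    obtain ⟨a, ha⟩ := ih
    obtain ⟨b, hb⟩ := φ.fv_bddAbove
    refine ⟨max a b, ?_⟩
    simp only [List.mem_cons, forall_eq_or_imp]
    exact ⟨fun m hm => lt_max_of_lt_right (hb m hm),
      fun ψ hψ m hm => lt_max_of_lt_left (ha ψ hψ m hm)⟩

/-- The substitution that turns the fresh variable `n` into the variable bound next. -/
def bindVar (n : ℕ) : ℕ → Tm := fun m =>
  if m = n then Language.Term.var 0 else Language.Term.var (m + 1)

theorem subst_bindVar {φ : Fml} {n : ℕ} (h : ∀ m ∈ φ.fv, m < n) : φ.subst (bindVar n) = φ.shift :=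
  Fml.subst_congr fun m hm => by simp [bindVar, (h m hm).ne]

theorem inst_subst_bindVar {φ : Fml} {n : ℕ} (h : ∀ m ∈ φ.fv, m ≤ n) :
    (φ.inst (Language.Term.var n)).subst (bindVar n) = φ := by
  rw [Fml.inst_subst_eq]
  conv_rhs => rw [← Fml.subst_sid φ]
  refine Fml.subst_congr fun m hm => ?_
  cases m with
  | zero => simp [bindVar]
  | succ m => have := h _ hm; simp [bindVar, show m ≠ n by omega]

theorem map_subst_bindVar {Γ : List Fml} {n : ℕ} (h : ∀ φ ∈ Γ, ∀ m ∈ φ.fv, m < n) :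
    Γ.map (·.subst (bindVar n)) = Γ.map Fml.shift :=
  List.map_congr_left fun φ hφ => subst_bindVar (h φ hφ)

/-- The instance at a fresh variable already suffices, since substitution turns that variable into
the bound one. With this rule and `exE_inst`, later derivations handle arbitrary terms `t` in an
unshifted context, and no bookkeeping of eigenvariables is needed. -/
theorem Derives.allI_inst {T : Set Fml} (hT : SubstClosed T) {Γ : List Fml} {φ : Fml}
    (h : ∀ t, Derives T Γ (φ.inst t)) : Derives T Γ φ.all := by
  obtain ⟨n, hn⟩ := exists_fresh (φ :: Γ)
  simp only [List.mem_cons, forall_eq_or_imp] at hn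
  have := (h (Language.Term.var n)).subst hT (bindVar n)
  rw [inst_subst_bindVar fun m hm => (hn.1 m hm).le, map_subst_bindVar hn.2] at this
  exact .allI this

theorem Derives.exE_inst {T : Set Fml} (hT : SubstClosed T) {Γ : List Fml} {φ ψ : Fml}
    (h₀ : Derives T Γ φ.ex) (h : ∀ t, Derives T (φ.inst t :: Γ) ψ) : Derives T Γ ψ := by
  obtain ⟨n, hn⟩ := exists_fresh (φ :: ψ :: Γ)
  simp only [List.mem_cons, forall_eq_or_imp] at hn
  have := (h (Language.Term.var n)).subst hT (bindVar n)
  rw [List.map_cons, inst_subst_bindVar fun m hm => (hn.1 m hm).le, map_subst_bindVar hn.2.2,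
    subst_bindVar hn.2.1] at this
  exact .exE h₀ this

/-! ### Derived rules -/

namespace Derives

variable {T : Set Fml} {Γ : List Fml} {φ ψ χ : Fml}

theorem wk (h : Derives T Γ φ) : Derives T (ψ :: Γ) φ := h.weaken (List.subset_cons_self _ _)

theorem hyp0 : Derives T (φ :: Γ) φ := .hyp (by simp)
theorem hyp1 : Derives T (ψ :: φ :: Γ) φ := .hyp (by simp)
theorem hyp2 {ξ : Fml} : Derives T (ξ :: ψ :: φ :: Γ) φ := .hyp (by simp)

theorem cut (h : Derives T Γ φ) (h' : Derives T (φ :: Γ) ψ) : Derives T Γ ψ := .impE (.impI h') h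

theorem imp_iff : Derives T Γ (φ.imp ψ) ↔ Derives T (φ :: Γ) ψ :=
  ⟨fun h => .impE h.wk hyp0, .impI⟩

theorem and_iff : Derives T Γ (φ.and ψ) ↔ Derives T Γ φ ∧ Derives T Γ ψ :=
  ⟨fun h => ⟨.andEl h, .andEr h⟩, fun h => .andI h.1 h.2⟩

theorem negI (h : Derives T (φ :: Γ) .bot) : Derives T Γ φ.neg := .impI h

theorem negE (h : Derives T Γ φ.neg) (h' : Derives T Γ φ) : Derives T Γ ψ := .botE (.impE h h')

theorem dnI (h : Derives T Γ φ) : Derives T Γ φ.neg.neg := negI (negE hyp0 h.wk)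

/-- Under a double negation one may reason from the formula itself towards `⊥`. -/
theorem dnE (h : Derives T Γ φ.neg.neg) (h' : Derives T (φ :: Γ) .bot) : Derives T Γ .bot :=
  .impE h (negI h')

theorem dn_map (h : Derives T Γ φ.neg.neg) (h' : Derives T (φ :: Γ) ψ) : Derives T Γ ψ.neg.neg :=
  negI (dnE h.wk (negE hyp1 (h'.weaken (by simp))))

theorem all_iff (hT : SubstClosed T) : Derives T Γ φ.all ↔ ∀ t, Derives T Γ (φ.inst t) :=
  ⟨fun h t => .allE t h, .allI_inst hT⟩

end Derives

/-- Equivalence over `T`, in every context. -/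
def Eqv (T : Set Fml) (φ ψ : Fml) : Prop := ∀ Γ, Derives T Γ φ ↔ Derives T Γ ψ

namespace Eqv

variable {T : Set Fml} {φ ψ χ φ' ψ' : Fml}

theorem refl (φ : Fml) : Eqv T φ φ := fun _ => Iff.rfl
theorem symm (h : Eqv T φ ψ) : Eqv T ψ φ := fun Γ => (h Γ).symm
theorem trans (h : Eqv T φ ψ) (h' : Eqv T ψ χ) : Eqv T φ χ := fun Γ => (h Γ).trans (h' Γ)

theorem proves_iff (h : Eqv T φ ψ) : Proves T (φ.iff ψ) :=
  .andI (.impI ((h _).1 .hyp0)) (.impI ((h _).2 .hyp0))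

theorem of_derives (h : Derives T [φ] ψ) (h' : Derives T [ψ] φ) : Eqv T φ ψ := fun _ =>
  ⟨fun d => d.cut (h.weaken (by simp)), fun d => d.cut (h'.weaken (by simp))⟩

theorem hyp_iff (h : Eqv T φ ψ) {Γ : List Fml} : Derives T (φ :: Γ) χ ↔ Derives T (ψ :: Γ) χ :=
  ⟨fun d => ((h _).2 .hyp0).cut (d.weaken (by grind)),
    fun d => ((h _).1 .hyp0).cut (d.weaken (by grind))⟩

theorem and (h : Eqv T φ φ') (h' : Eqv T ψ ψ') : Eqv T (φ.and ψ) (φ'.and ψ') := fun Γ => by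
  rw [Derives.and_iff, Derives.and_iff, h Γ, h' Γ]

theorem imp (h : Eqv T φ φ') (h' : Eqv T ψ ψ') : Eqv T (φ.imp ψ) (φ'.imp ψ') := fun Γ => by
  rw [Derives.imp_iff, Derives.imp_iff, h.hyp_iff, h' _]

theorem neg (h : Eqv T φ φ') : Eqv T φ.neg φ'.neg := h.imp (refl _)

theorem or (h : Eqv T φ φ') (h' : Eqv T ψ ψ') : Eqv T (φ.or ψ) (φ'.or ψ') := fun _ =>
  ⟨fun d => .orE d (.orIl ((h _).1 .hyp0)) (.orIr ((h' _).1 .hyp0)),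
    fun d => .orE d (.orIl ((h _).2 .hyp0)) (.orIr ((h' _).2 .hyp0))⟩

theorem subst (hT : SubstClosed T) (h : Eqv T φ ψ) (σ : ℕ → Tm) :
    Eqv T (φ.subst σ) (ψ.subst σ) :=
  of_derives (((h _).1 (.hyp0 (Γ := []))).subst hT σ) (((h _).2 (.hyp0 (Γ := []))).subst hT σ)

theorem all_of_inst (hT : SubstClosed T) (h : ∀ t, Eqv T (φ.inst t) (ψ.inst t)) :
    Eqv T φ.all ψ.all := fun Γ => by
  simp only [Derives.all_iff hT, fun t => h t Γ]

theorem ex_of_inst (hT : SubstClosed T) (h : ∀ t, Eqv T (φ.inst t) (ψ.inst t)) :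
    Eqv T φ.ex ψ.ex := fun _ =>
  ⟨fun d => .exE_inst hT d fun t => .exI t ((h t _).1 .hyp0),
    fun d => .exE_inst hT d fun t => .exI t ((h t _).2 .hyp0)⟩

theorem all (hT : SubstClosed T) (h : Eqv T φ ψ) : Eqv T φ.all ψ.all :=
  all_of_inst hT fun t => by simpa only [Fml.inst_eq] using h.subst hT _

theorem ex (hT : SubstClosed T) (h : Eqv T φ ψ) : Eqv T φ.ex ψ.ex :=
  ex_of_inst hT fun t => by simpa only [Fml.inst_eq] using h.subst hT _

theorem not_ex (hT : SubstClosed T) (φ : Fml) : Eqv T φ.ex.neg φ.neg.all := fun _ =>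
  ⟨fun d => .allI_inst hT fun t => .negI (d.wk.negE (.exI t .hyp0)),
    fun d => .negI (.exE_inst hT .hyp0 fun t => .negE (.allE t d.wk.wk) .hyp0)⟩

end Eqv

/-! ### Arithmetic -/

/-- A substitution-closed theory that contains `HA`. -/
structure ArithTheory (T : Set Fml) : Prop where
  substClosed : SubstClosed T
  ha : HA ⊆ T

theorem mkApp_update_subst {n : ℕ} (f : PRSymb n) (v : Fin n → Tm) (i : Fin n) (t : Tm)
    (σ : ℕ → Tm) : (mkApp f (Function.update v i t)).subst σ =
      mkApp f (Function.update (fun j => (v j).subst σ) i (t.subst σ)) := by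
  simp only [mkApp_subst]
  congr 1
  funext j
  by_cases h : j = i
  · subst h; simp
  · simp [h]

theorem subst_vecCons {n : ℕ} (t : Tm) (v : Fin n → Tm) (σ : ℕ → Tm) :
    (fun i => (Matrix.vecCons t v i).subst σ) =
      Matrix.vecCons (t.subst σ) fun i => (v i).subst σ := by
  funext i
  refine Fin.cases ?_ (fun j => ?_) i <;> rfl

theorem HA_substClosed : SubstClosed HA := by
  intro φ h σ
  cases h with
  | eqRefl t => exact .eqRefl _
  | eqEucl t u r => exact .eqEucl _ _ _
  | eqCongr f v i t u =>
    simp only [Fml.subst, mkApp_update_subst]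
    exact .eqCongr _ _ _ _ _
  | succNeZero t =>
    simp only [Fml.subst, Fml.neg, succT_subst, zeroT_subst]
    exact .succNeZero _
  | succInj t u =>
    simp only [Fml.subst, succT_subst]
    exact .succInj _ _
  | projEq i v => exact .projEq _ _
  | compEq f g v => exact .compEq _ _ _
  | precZero f g v =>
    simp only [Fml.subst, mkApp_subst, subst_vecCons, zeroT_subst]
    exact .precZero _ _ _
  | precSucc f g t v =>
    simp only [Fml.subst, mkApp_subst, subst_vecCons, succT_subst]
    exact .precSucc _ _ _ _
  | induction φ =>
    have : _ ∈ HA := HA.induction (φ.subst (liftSubst σ))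
    simp only [Fml.subst, Fml.inst_eq, Fml.instSucc_eq, liftSubst_eq] at this ⊢
    simpa [Language.Term.subst] using this

theorem arithTheory_HA : ArithTheory HA := ⟨HA_substClosed, subset_rfl⟩

namespace ArithTheory

variable {T : Set Fml} (hT : ArithTheory T) {Γ : List Fml}
include hT

theorem eq_refl (t : Tm) : Derives T Γ (.eq t t) := .ax (hT.ha (.eqRefl t))

theorem eq_symm {t u : Tm} (h : Derives T Γ (.eq t u)) : Derives T Γ (.eq u t) :=
  .impE (.impE (.ax (hT.ha (.eqEucl t u t))) h) (hT.eq_refl t)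

theorem eq_trans {t u r : Tm} (h : Derives T Γ (.eq t u)) (h' : Derives T Γ (.eq u r)) :
    Derives T Γ (.eq t r) :=
  .impE (.impE (.ax (hT.ha (.eqEucl u t r))) (hT.eq_symm h)) h'

theorem eq_congr {n : ℕ} (f : PRSymb n) {v w : Fin n → Tm}
    (h : ∀ i, Derives T Γ (.eq (v i) (w i))) : Derives T Γ (.eq (mkApp f v) (mkApp f w)) := by
  -- The congruence axiom changes one argument at a time, so the first `k` arguments are replaced
  -- successively.
  have key : ∀ k ≤ n, Derives T Γ (.eq (mkApp f v)
      (mkApp f fun i => if i.1 < k then w i else v i)) := by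
    intro k
    induction k with
    | zero => intro _; simpa using hT.eq_refl _
    | succ k ih =>
      intro hk
      refine hT.eq_trans (ih (by omega)) ?_
      have := Derives.impE (.ax (hT.ha (.eqCongr f (fun i => if i.1 < k then w i else v i)
        ⟨k, hk⟩ _ _))) (h ⟨k, hk⟩)
      convert this using 3
      · funext i
        by_cases hi : i = ⟨k, hk⟩
        · subst hi; simp
        · simp [hi]
      · funext i
        by_cases hi : i = ⟨k, hk⟩
        · subst hi; simp
        · have : i.1 ≠ k := fun h => hi (Fin.ext h)
          simp only [ne_eq, hi, not_false_eq_true, Function.update_of_ne]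
          split_ifs <;> first | rfl | omega
  simpa using key n le_rfl

theorem subst_tm_congr (t : Tm) {σ τ : ℕ → Tm} (h : ∀ n, Derives T Γ (.eq (σ n) (τ n))) :
    Derives T Γ (.eq (t.subst σ) (t.subst τ)) := by
  induction t with
  | var n => exact h n
  | func f ts ih => exact hT.eq_congr f ih

/-- Leibniz's law is axiomatized for terms only; it extends to formulas by recursion. The
contravariant side of an implication uses symmetry of equality. -/
theorem subst_congr (φ : Fml) {σ τ : ℕ → Tm} (h : ∀ n, Derives T Γ (.eq (σ n) (τ n)))
    (d : Derives T Γ (φ.subst σ)) : Derives T Γ (φ.subst τ) := by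
  have hs : ∀ {Γ : List Fml} {σ τ : ℕ → Tm} (t : Tm), (∀ n, Derives T Γ (.eq (σ n) (τ n))) →
      ∀ n, Derives T Γ (.eq (scons t σ n) (scons t τ n)) := by
    intro Γ σ τ t h n
    cases n
    · exact hT.eq_refl _
    · exact h _
  induction φ generalizing Γ σ τ with
  | bot => exact d
  | eq t u =>
    exact hT.eq_trans (hT.eq_symm (hT.subst_tm_congr t h)) (hT.eq_trans d (hT.subst_tm_congr u h))
  | and φ ψ h₁ h₂ => exact .andI (h₁ h d.andEl) (h₂ h d.andEr)
  | or φ ψ h₁ h₂ =>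
    exact .orE d (.orIl (h₁ (fun n => (h n).wk) .hyp0)) (.orIr (h₂ (fun n => (h n).wk) .hyp0))
  | imp φ ψ h₁ h₂ =>
    exact .impI (h₂ (fun n => (h n).wk) (.impE d.wk (h₁ (fun n => hT.eq_symm (h n).wk) .hyp0)))
  | all φ ih =>
    refine .allI_inst hT.substClosed fun t => ?_
    rw [Fml.subst_liftSubst_inst]
    refine ih (hs t h) ?_
    rw [← Fml.subst_liftSubst_inst]
    exact .allE t d
  | ex φ ih =>
    refine .exE_inst hT.substClosed d fun t => .exI t ?_
    rw [Fml.subst_liftSubst_inst, Fml.subst_liftSubst_inst]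
    exact ih (hs t fun n => (h n).wk) .hyp0

theorem induction (φ : Fml) (h₀ : Derives T Γ (φ.inst zeroT))
    (h : ∀ t, Derives T (φ.inst t :: Γ) (φ.inst (succT t))) (t : Tm) : Derives T Γ (φ.inst t) := by
  refine .allE t (.impE (.impE (.ax (hT.ha (.induction φ))) h₀) ?_)
  refine .allI_inst hT.substClosed fun t => ?_
  have : φ.instSucc.inst t = φ.inst (succT t) := by
    simp [Fml.instSucc_eq, Fml.inst_eq, Language.Term.subst]
  rw [Fml.inst_imp, this]
  exact .impI (h t)

theorem succ_congr {t u : Tm} (h : Derives T Γ (.eq t u)) :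
    Derives T Γ (.eq (succT t) (succT u)) :=
  hT.eq_congr _ fun i => by fin_cases i; exact h

theorem succ_inj {t u : Tm} (h : Derives T Γ (.eq (succT t) (succT u))) :
    Derives T Γ (.eq t u) :=
  .impE (.ax (hT.ha (.succInj t u))) h

theorem succ_ne_zero {t : Tm} {φ : Fml} (h : Derives T Γ (.eq (succT t) zeroT)) :
    Derives T Γ φ :=
  .negE (.ax (hT.ha (.succNeZero t))) h

theorem cases_tm (t : Tm) {φ : Fml} (h₀ : Derives T (.eq t zeroT :: Γ) φ)
    (h : ∀ u, Derives T (.eq t (succT u) :: Γ) φ) : Derives T Γ φ := by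
  have key := hT.induction (Γ := Γ) (.or (.eq (.var 0) zeroT) (.ex (.eq (.var 1) (succT (.var 0)))))
    (.orIl (by simpa [Fml.inst_eq, Fml.subst, Language.Term.subst] using hT.eq_refl _))
    (fun t => .orIr (.exI t (by
      simpa [Fml.inst_eq, Fml.subst, liftSubst_eq, scomp_apply,
        Language.Term.subst] using hT.eq_refl _))) t
  simp only [Fml.inst_eq, Fml.subst, Language.Term.subst, scons_zero, zeroT_subst] at key
  refine .orE key h₀ (.exE_inst hT.substClosed .hyp0 fun u => ?_)
  refine ((h u).weaken ?_)
  simp [Fml.inst_eq, Fml.subst, liftSubst_eq, Language.Term.subst]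

/-- Induction on `x` for a statement `∀ y, β(y, x)`. -/
theorem induction_all (β : Fml) (h₀ : ∀ u, Derives T Γ (β.subst (scons u (scons zeroT sid))))
    (h : ∀ t u Δ, Γ ⊆ Δ → (∀ w, Derives T Δ (β.subst (scons w (scons t sid)))) →
      Derives T Δ (β.subst (scons u (scons (succT t) sid)))) (t u : Tm) :
    Derives T Γ (β.subst (scons u (scons t sid))) := by
  have e : ∀ t u, (β.subst (scons (Language.Term.var 0) (scons (t.subst sshift) sshift))).inst u =
      β.subst (scons u (scons t sid)) := by
    intro t u
    simp [Fml.inst_eq, Language.Term.subst]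
  have e' : ∀ t, β.all.inst t =
      (β.subst (scons (Language.Term.var 0) (scons (t.subst sshift) sshift))).all := by
    intro t
    simp [Fml.inst_eq, Fml.subst, liftSubst_eq]
  have key := hT.induction (Γ := Γ) β.all
    (by rw [e']; exact .allI_inst hT.substClosed fun u => by rw [e]; exact h₀ u)
    (fun t => by
      rw [e', e']
      refine .allI_inst hT.substClosed fun u => ?_
      rw [e]
      refine h t u _ (by simp) fun w => ?_
      rw [← e]
      exact .allE w .hyp0) t
  rw [e'] at key
  rw [← e]
  exact .allE u key

/-- Induction on `t` for all `u` at once, with a case distinction on whether `u` is zero or a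
successor. This is the source of excluded middle for all quantifier-free formulas. -/
theorem eq_em (t u : Tm) : Derives T Γ ((Fml.eq t u).or (Fml.eq t u).neg) := by
  have key := hT.induction_all (Γ := Γ)
    ((Fml.eq (.var 1) (.var 0)).or (Fml.eq (.var 1) (.var 0)).neg)
  simp only [Fml.subst, Fml.neg, Language.Term.subst, scons_succ, scons_zero] at key
  refine key (fun u => ?_) (fun t u Δ _ ih => ?_) t u
  · refine hT.cases_tm u (.orIl (hT.eq_symm .hyp0)) fun w => .orIr (.negI ?_)
    exact hT.succ_ne_zero (hT.eq_symm (hT.eq_trans .hyp0 .hyp1))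
  · refine hT.cases_tm u (.orIr (.negI ?_)) fun w => ?_
    · exact hT.succ_ne_zero (hT.eq_trans .hyp0 .hyp1)
    · refine .orE (ih w).wk (.orIl ?_) (.orIr (.negI (.negE .hyp1 ?_)))
      · exact hT.eq_trans (hT.succ_congr .hyp0) (hT.eq_symm .hyp1)
      · exact hT.succ_inj (hT.eq_trans .hyp0 .hyp2)

theorem qf_em {φ : Fml} (h : φ.IsQF) : Derives T Γ (φ.or φ.neg) := by
  induction φ generalizing Γ with
  | bot => exact .orIr (.negI .hyp0)
  | eq t u => exact hT.eq_em t u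
  | and φ ψ h₁ h₂ =>
    refine .orE (h₁ h.1) (.orE (h₂ h.2) (.orIl (.andI .hyp1 .hyp0)) (.orIr (.negI ?_)))
      (.orIr (.negI ?_))
    · exact .negE .hyp1 (.andEr .hyp0)
    · exact .negE .hyp1 (.andEl .hyp0)
  | or φ ψ h₁ h₂ =>
    refine .orE (h₁ h.1) (.orIl (.orIl .hyp0)) (.orE (h₂ h.2) (.orIl (.orIr .hyp0))
      (.orIr (.negI (.orE .hyp0 ?_ ?_))))
    · exact .negE (.hyp (by simp)) .hyp0
    · exact .negE (.hyp (by simp)) .hyp0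
  | imp φ ψ h₁ h₂ =>
    refine .orE (h₂ h.2) (.orIl (.impI .hyp1)) (.orE (h₁ h.1) (.orIr (.negI ?_))
      (.orIl (.impI (.negE .hyp1 .hyp0))))
    exact .negE .hyp2 (.impE .hyp0 .hyp1)
  | all φ => exact h.elim
  | ex φ => exact h.elim

end ArithTheory

/-! ### An injective pairing function -/

/-- `x ↦ 2 x` -/
def dblSymb : PRSymb 1 := .prec .zero (.comp .succ ![.comp .succ ![.proj 1] ])

/-- `(x, y) ↦ 2 ^ x * (2 y + 1)` -/
def pairSymb : PRSymb 2 :=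
  .prec (.comp .succ ![dblSymb]) (.comp dblSymb ![.proj 1])

def dblT (t : Tm) : Tm := mkApp dblSymb ![t]
def pairT (t u : Tm) : Tm := mkApp pairSymb ![t, u]

@[simp] theorem dblT_subst (t : Tm) (σ : ℕ → Tm) : (dblT t).subst σ = dblT (t.subst σ) := by
  simp only [dblT, mkApp_subst]
  congr 1
  funext i
  fin_cases i
  rfl

@[simp] theorem pairT_subst (t u : Tm) (σ : ℕ → Tm) :
    (pairT t u).subst σ = pairT (t.subst σ) (u.subst σ) := by
  simp only [pairT, mkApp_subst]
  congr 1
  funext i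
  fin_cases i <;> rfl

namespace ArithTheory

variable {T : Set Fml} (hT : ArithTheory T) {Γ : List Fml}
include hT

theorem dbl_zero : Derives T Γ (.eq (dblT zeroT) zeroT) :=
  .ax (hT.ha (.precZero _ _ ![]))

theorem comp_unary {m : ℕ} (f : PRSymb 1) (g : PRSymb m) (v : Fin m → Tm) :
    Derives T Γ (.eq (mkApp (.comp f ![g]) v) (mkApp f ![mkApp g v])) := by
  have := HA.compEq f ![g] v
  rw [show (fun i => mkApp (![g] i) v) = ![mkApp g v] by funext i; fin_cases i; rfl] at this
  exact .ax (hT.ha this)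

theorem unary_congr (f : PRSymb 1) {t u : Tm} (h : Derives T Γ (.eq t u)) :
    Derives T Γ (.eq (mkApp f ![t]) (mkApp f ![u])) :=
  hT.eq_congr _ fun i => by fin_cases i; exact h

theorem dbl_succ (t : Tm) : Derives T Γ (.eq (dblT (succT t)) (succT (succT (dblT t)))) := by
  refine hT.eq_trans (.ax (hT.ha (.precSucc _ _ t ![]))) ?_
  refine hT.eq_trans (hT.comp_unary _ _ _) (hT.succ_congr ?_)
  exact hT.eq_trans (hT.comp_unary _ _ _) (hT.succ_congr (.ax (hT.ha (.projEq _ _))))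

theorem pair_zero (u : Tm) : Derives T Γ (.eq (pairT zeroT u) (succT (dblT u))) :=
  hT.eq_trans (.ax (hT.ha (.precZero _ _ ![u]))) (hT.comp_unary _ _ _)

theorem pair_succ (t u : Tm) : Derives T Γ (.eq (pairT (succT t) u) (dblT (pairT t u))) := by
  refine hT.eq_trans (.ax (hT.ha (.precSucc _ _ t ![u]))) ?_
  exact hT.eq_trans (hT.comp_unary _ _ _) (hT.unary_congr _ (.ax (hT.ha (.projEq _ _))))

theorem pair_congr_left {t u r : Tm} (h : Derives T Γ (.eq t u)) :
    Derives T Γ (.eq (pairT t r) (pairT u r)) :=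
  hT.eq_congr _ fun i => by
    fin_cases i
    · exact h
    · exact hT.eq_refl _

theorem dbl_inj {t u : Tm} (h : Derives T Γ (.eq (dblT t) (dblT u))) : Derives T Γ (.eq t u) := by
  have key := hT.induction_all (Γ := Γ)
    ((Fml.eq (dblT (.var 1)) (dblT (.var 0))).imp (.eq (.var 1) (.var 0)))
  simp only [Fml.subst, Language.Term.subst, scons_succ, scons_zero, dblT_subst] at key
  refine .impE (key (fun u => .impI ?_) (fun t u Δ _ ih => .impI ?_) t u) h
  · refine hT.cases_tm u (hT.eq_symm .hyp0) fun w => hT.succ_ne_zero (t := succT (dblT w)) ?_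
    exact hT.eq_trans (hT.eq_symm (hT.dbl_succ w)) (hT.eq_trans
      (hT.eq_symm (hT.unary_congr _ .hyp0)) (hT.eq_trans (hT.eq_symm .hyp1) hT.dbl_zero))
  · refine hT.cases_tm u (hT.succ_ne_zero (t := succT (dblT t)) ?_) fun w => ?_
    · exact hT.eq_trans (hT.eq_symm (hT.dbl_succ t)) (hT.eq_trans .hyp1
        (hT.eq_trans (hT.unary_congr _ .hyp0) hT.dbl_zero))
    · refine hT.eq_trans (hT.succ_congr (.impE (ih w).wk.wk ?_)) (hT.eq_symm .hyp0)
      refine hT.succ_inj (hT.succ_inj ?_)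
      exact hT.eq_trans (hT.eq_symm (hT.dbl_succ t)) (hT.eq_trans .hyp1
        (hT.eq_trans (hT.unary_congr _ .hyp0) (hT.dbl_succ w)))

theorem dbl_ne_succ_dbl {t u : Tm} {φ : Fml} (h : Derives T Γ (.eq (dblT t) (succT (dblT u)))) :
    Derives T Γ φ := by
  have key := hT.induction_all (Γ := Γ)
    (Fml.eq (dblT (.var 1)) (succT (dblT (.var 0)))).neg
  simp only [Fml.neg, Fml.subst, Language.Term.subst, scons_succ, scons_zero, dblT_subst,
    succT_subst] at key
  refine .negE (key (fun u => .impI ?_) (fun t u Δ _ ih => .impI ?_) t u) h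
  · exact hT.succ_ne_zero (hT.eq_trans (hT.eq_symm .hyp0) hT.dbl_zero)
  · have e : Derives T (.eq (dblT (succT t)) (succT (dblT u)) :: Δ)
        (.eq (succT (dblT t)) (dblT u)) :=
      hT.succ_inj (hT.eq_trans (hT.eq_symm (hT.dbl_succ t)) .hyp0)
    refine hT.cases_tm u ?_ fun w => ?_
    · exact hT.succ_ne_zero (hT.eq_trans e.wk (hT.eq_trans (hT.unary_congr _ .hyp0) hT.dbl_zero))
    · refine .impE (ih w).wk.wk (hT.succ_inj (hT.eq_trans e.wk ?_))
      exact hT.eq_trans (hT.unary_congr _ .hyp0) (hT.dbl_succ w)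

/-- The pair with first component 0 is odd and one with a successor there is even, so parity
excludes the mixed cases. In the others `dbl_inj` strips a factor 2 and the induction on the first
component proceeds. Projections are never needed, injectivity suffices. -/
theorem pair_inj {t u r s : Tm} (h : Derives T Γ (.eq (pairT t r) (pairT u s))) :
    Derives T Γ (.eq t u) ∧ Derives T Γ (.eq r s) := by
  rw [← Derives.and_iff]
  have key := hT.induction_all (Γ := Γ) (.imp (.eq (pairT (.var 1) (r.subst (scomp sshift sshift)))
    (pairT (.var 0) (s.subst (scomp sshift sshift))))
    (.and (.eq (.var 1) (.var 0))
      (.eq (r.subst (scomp sshift sshift)) (s.subst (scomp sshift sshift)))))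
  simp only [Fml.subst, Language.Term.subst, scons_succ, scons_zero, pairT_subst,
    Tm.subst_subst, scomp_assoc, sshift_scomp_scons, Tm.subst_sid] at key
  refine .impE (key (fun u => .impI ?_) (fun t u Δ _ ih => .impI ?_) t u) h
  · refine hT.cases_tm u (.andI (hT.eq_symm .hyp0) ?_) fun w => ?_
    · refine hT.dbl_inj (hT.succ_inj (hT.eq_trans (hT.eq_symm (hT.pair_zero _)) ?_))
      exact hT.eq_trans .hyp1 (hT.eq_trans (hT.pair_congr_left .hyp0) (hT.pair_zero _))
    · refine hT.dbl_ne_succ_dbl (t := pairT w s) (u := r) ?_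
      refine hT.eq_trans (hT.eq_symm (hT.pair_succ _ _)) ?_
      exact hT.eq_trans (hT.pair_congr_left (hT.eq_symm .hyp0))
        (hT.eq_trans (hT.eq_symm .hyp1) (hT.pair_zero _))
  · refine hT.cases_tm u ?_ fun w => ?_
    · refine hT.dbl_ne_succ_dbl (t := pairT t r) (u := s) ?_
      refine hT.eq_trans (hT.eq_symm (hT.pair_succ _ _)) ?_
      exact hT.eq_trans .hyp1 (hT.eq_trans (hT.pair_congr_left .hyp0) (hT.pair_zero _))
    · have e : Derives T (.eq u (succT w) :: .eq (pairT (succT t) r) (pairT u s) :: Δ)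
          (.eq (pairT t r) (pairT w s)) := by
        refine hT.dbl_inj (hT.eq_trans (hT.eq_symm (hT.pair_succ _ _)) ?_)
        exact hT.eq_trans .hyp1 (hT.eq_trans (hT.pair_congr_left .hyp0) (hT.pair_succ _ _))
      have ih' := Derives.impE (ih w).wk.wk e
      exact .andI (hT.eq_trans (hT.succ_congr ih'.andEl) (hT.eq_symm .hyp0)) ih'.andEr

end ArithTheory

/-! ### The negative translation with `⊥` replaced by an arbitrary formula -/

namespace Fml

/-- The negative translation combined with Friedman's translation: `⊥` becomes `R`. -/
def tr : Fml → Fml → Fml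
  | bot, R => R
  | eq t u, R => ((eq t u).imp R).imp R
  | and φ ψ, R => (φ.tr R).and (ψ.tr R)
  | or φ ψ, R => (((φ.tr R).imp R).and ((ψ.tr R).imp R)).imp R
  | imp φ ψ, R => (φ.tr R).imp (ψ.tr R)
  | all φ, R => (φ.tr R.shift).all
  | ex φ, R => ((φ.tr R.shift).imp R.shift).all.imp R

theorem tr_subst (φ R : Fml) (σ : ℕ → Tm) :
    (φ.subst σ).tr (R.subst σ) = (φ.tr R).subst σ := by
  induction φ generalizing R σ with
  | bot => rfl
  | eq => rfl
  | and φ ψ h₁ h₂ | or φ ψ h₁ h₂ | imp φ ψ h₁ h₂ => simp [subst, tr, h₁, h₂]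
  | all φ ih | ex φ ih => simp [subst, tr, ← shift_subst_liftSubst, ih]

theorem tr_shift (φ R : Fml) : φ.shift.tr R.shift = (φ.tr R).shift := tr_subst _ _ _

theorem tr_inst (φ R : Fml) (t : Tm) : (φ.inst t).tr R = (φ.tr R.shift).inst t := by
  rw [inst_eq, inst_eq, ← tr_subst, shift_subst_scons, subst_sid]

theorem tr_instSucc (φ R : Fml) : φ.instSucc.tr R.shift = (φ.tr R.shift).instSucc := by
  rw [instSucc_eq, instSucc_eq, ← tr_subst, shift_subst_scons, shift_eq]

theorem subst_liftSubst_sshift_inst (φ : Fml) :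
    (φ.subst (liftSubst sshift)).inst (Language.Term.var 0) = φ := by
  simp

end Fml

theorem map_tr_shift (Γ : List Fml) (R : Fml) :
    (Γ.map Fml.shift).map (·.tr R.shift) = (Γ.map (·.tr R)).map Fml.shift := by
  simp [Fml.tr_shift]

namespace Derives

variable {T : Set Fml}

theorem triple_imp {Γ : List Fml} {φ R : Fml} (h : Derives T Γ (((φ.imp R).imp R).imp R)) :
    Derives T Γ (φ.imp R) :=
  .impI (.impE h.wk (.impI (.impE .hyp0 .hyp1)))

theorem relI {Γ : List Fml} {φ R : Fml} (h : Derives T Γ φ) : Derives T Γ ((φ.imp R).imp R) :=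
  .impI (.impE .hyp0 h.wk)

/-- Atoms, `∨` and `∃` are translated to formulas ending in `→ R`, and the other connectives
preserve stability relative to R. -/
theorem tr_stable (hT : SubstClosed T) {Γ : List Fml} {φ R : Fml}
    (h : Derives T Γ (((φ.tr R).imp R).imp R)) : Derives T Γ (φ.tr R) := by
  induction φ generalizing Γ R with
  | bot => exact .impE h (.impI .hyp0)
  | eq t u => exact triple_imp h
  | and φ ψ h₁ h₂ =>
    exact .andI (h₁ (.impI (.impE h.wk (.impI (.impE .hyp1 (.andEl .hyp0))))))
      (h₂ (.impI (.impE h.wk (.impI (.impE .hyp1 (.andEr .hyp0))))))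
  | or φ ψ => exact triple_imp h
  | imp φ ψ h₁ h₂ =>
    exact .impI (h₂ (.impI (.impE h.wk.wk (.impI (.impE .hyp1 (.impE .hyp0 .hyp2))))))
  | all φ ih =>
    refine .allI (ih (.impI (.impE (h.subst hT sshift).wk (.impI (.impE .hyp1 ?_)))))
    have := Derives.allE (T := T) (Language.Term.var 0)
      (.hyp0 (Γ := ((φ.tr R.shift).imp R.shift) :: Γ.map Fml.shift)
        (φ := ((φ.tr R.shift).subst (liftSubst sshift)).all))
    rwa [Fml.subst_liftSubst_sshift_inst] at this
  | ex φ => exact triple_imp h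

/-- It suffices to derive `R` from the `R`-negation of a translated formula. -/
theorem tr_of_contra (hT : SubstClosed T) {Γ : List Fml} {φ R : Fml}
    (h : Derives T ((φ.tr R).imp R :: Γ) R) : Derives T Γ (φ.tr R) :=
  tr_stable hT (.impI h)

end Derives

theorem HA_tr {φ : Fml} (h : φ ∈ HA) (R : Fml) (Γ : List Fml) : Derives HA Γ (φ.tr R) := by
  have imp_tr : ∀ {Γ : List Fml} {φ ψ : Fml}, Derives HA Γ (φ.imp ψ) →
      Derives HA Γ (((φ.imp R).imp R).imp ((ψ.imp R).imp R)) := fun h =>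
    .impI (.impI (.impE .hyp1 (.impI (.impE .hyp1 (.impE h.wk.wk.wk .hyp0)))))
  cases h with
  | eqRefl t => exact .relI (.ax (.eqRefl _))
  | eqEucl t u r =>
    refine .impI (.impI (.impI (.impE .hyp2 (.impI (.impE .hyp2 (.impI ?_))))))
    exact .impE .hyp2 (.impE (.impE (.ax (.eqEucl t u r)) .hyp1) .hyp0)
  | eqCongr f v i t u => exact imp_tr (.ax (.eqCongr _ _ _ _ _))
  | succNeZero t =>
    exact .impI (.impE .hyp0 (.impI (.negE (.ax (.succNeZero t)) .hyp0)))
  | succInj t u => exact imp_tr (.ax (.succInj _ _))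
  | projEq i v => exact .relI (.ax (.projEq _ _))
  | compEq f g v => exact .relI (.ax (.compEq _ _ _))
  | precZero f g v => exact .relI (.ax (.precZero _ _ _))
  | precSucc f g t v => exact .relI (.ax (.precSucc _ _ _ _))
  | induction φ =>
    simp only [Fml.tr, Fml.tr_inst, Fml.tr_instSucc]
    exact .ax (.induction _)

/-- Soundness of the translation. -/
theorem derives_tr {Γ : List Fml} {φ : Fml} (h : Derives PA Γ φ) (R : Fml) :
    Derives HA (Γ.map (·.tr R)) (φ.tr R) := by
  have hs := HA_substClosed
  induction h generalizing R with
  | ax h =>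
    rcases h with h | ⟨φ, rfl⟩
    · exact HA_tr h R _
    -- Excluded middle becomes `((φ → R) ∧ ((φ → R) → R)) → R` for the translated φ, which is
    -- intuitionistically valid.
    · exact .impI (.impE (.andEr .hyp0) (.andEl .hyp0))
  | hyp h => exact .hyp (List.mem_map_of_mem h)
  | botE _ ih => exact .tr_of_contra hs (ih R).wk
  | andI _ _ h₁ h₂ => exact .andI (h₁ R) (h₂ R)
  | andEl _ ih => exact .andEl (ih R)
  | andEr _ ih => exact .andEr (ih R)
  | orIl _ ih => exact .impI (.impE (.andEl .hyp0) (ih R).wk)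
  | orIr _ ih => exact .impI (.impE (.andEr .hyp0) (ih R).wk)
  | orE _ _ _ h₁ h₂ h₃ =>
    -- A translated disjunction eliminates only into `R`; stability of the translated conclusion
    -- reduces the goal to `R`.
    refine .tr_of_contra hs (.impE (h₁ R).wk (.andI ?_ ?_))
    · exact .impI (.impE .hyp1 ((h₂ R).weaken (by simp)))
    · exact .impI (.impE .hyp1 ((h₃ R).weaken (by simp)))
  | impI _ ih => exact .impI (ih R)
  | impE _ _ h₁ h₂ => exact .impE (h₁ R) (h₂ R)
  | allI _ ih =>
    have := ih R.shift
    rw [map_tr_shift] at this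
    exact .allI this
  | allE t _ ih =>
    rw [Fml.tr_inst]
    exact .allE t (ih R)
  | @exI Γ φ t _ ih =>
    have := ih R
    rw [Fml.tr_inst] at this
    refine .impI ?_
    have h' := Derives.allE (T := HA) t (.hyp0 (Γ := Γ.map (·.tr R))
      (φ := ((φ.tr R.shift).imp R.shift).all))
    rw [Fml.inst_imp, Fml.shift_inst] at h'
    exact .impE h' this.wk
  | @exE Γ φ ψ _ _ h₁ h₂ =>
    refine .tr_of_contra hs (.impE (h₁ R).wk (.allI (.impI ?_)))
    have := h₂ R.shift
    rw [List.map_cons, map_tr_shift, Fml.tr_shift] at this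
    exact .impE .hyp1 (this.weaken (by simp))

/-! ### Prenex classes up to provable equivalence -/

theorem mem_sigmaClass_succ {j : ℕ} {φ : Fml} : φ ∈ SigmaClass (j + 1) ↔
    ∃ ψ, φ = ψ.ex ∧ (ψ ∈ SigmaClass (j + 1) ∨ ψ ∈ PiClass j) := by
  have e : ∀ φ, φ ∈ SigmaClass (j + 1) ↔ ∃ n, ∃ ψ ∈ PiClass j, φ = Fml.ex^[n + 1] ψ := fun φ => by
    rw [SigmaClass]; rfl
  constructor
  · rw [e]
    rintro ⟨n, ψ, hψ, rfl⟩
    refine ⟨Fml.ex^[n] ψ, Function.iterate_succ_apply' _ _ _, ?_⟩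
    cases n with
    | zero => exact .inr hψ
    | succ n => exact .inl ((e _).2 ⟨n, ψ, hψ, rfl⟩)
  · rintro ⟨ψ, rfl, h | h⟩
    · obtain ⟨n, χ, hχ, rfl⟩ := (e _).1 h
      exact (e _).2 ⟨n + 1, χ, hχ, (Function.iterate_succ_apply' _ _ _).symm⟩
    · exact (e _).2 ⟨0, ψ, h, rfl⟩

theorem mem_piClass_succ {j : ℕ} {φ : Fml} : φ ∈ PiClass (j + 1) ↔
    ∃ ψ, φ = ψ.all ∧ (ψ ∈ PiClass (j + 1) ∨ ψ ∈ SigmaClass j) := by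
  have e : ∀ φ, φ ∈ PiClass (j + 1) ↔ ∃ n, ∃ ψ ∈ SigmaClass j, φ = Fml.all^[n + 1] ψ := fun φ => by
    rw [PiClass]; rfl
  constructor
  · rw [e]
    rintro ⟨n, ψ, hψ, rfl⟩
    refine ⟨Fml.all^[n] ψ, Function.iterate_succ_apply' _ _ _, ?_⟩
    cases n with
    | zero => exact .inr hψ
    | succ n => exact .inl ((e _).2 ⟨n, ψ, hψ, rfl⟩)
  · rintro ⟨ψ, rfl, h | h⟩
    · obtain ⟨n, χ, hχ, rfl⟩ := (e _).1 h
      exact (e _).2 ⟨n + 1, χ, hχ, (Function.iterate_succ_apply' _ _ _).symm⟩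
    · exact (e _).2 ⟨0, ψ, h, rfl⟩

theorem mem_sigmaClass_zero {φ : Fml} : φ ∈ SigmaClass 0 ↔ φ.IsQF := by rw [SigmaClass]; rfl
theorem mem_piClass_zero {φ : Fml} : φ ∈ PiClass 0 ↔ φ.IsQF := by rw [PiClass]; rfl

/-- Induction over the whole prenex hierarchy. -/
theorem prenex_induction {P Q : ℕ → Fml → Prop}
    (hP₀ : ∀ φ, φ.IsQF → P 0 φ) (hQ₀ : ∀ φ, φ.IsQF → Q 0 φ)
    (hP : ∀ j φ, φ ∈ SigmaClass (j + 1) ∧ P (j + 1) φ ∨ φ ∈ PiClass j ∧ Q j φ → P (j + 1) φ.ex)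
    (hQ : ∀ j φ, φ ∈ PiClass (j + 1) ∧ Q (j + 1) φ ∨ φ ∈ SigmaClass j ∧ P j φ → Q (j + 1) φ.all)
    (j : ℕ) (φ : Fml) : (φ ∈ SigmaClass j → P j φ) ∧ (φ ∈ PiClass j → Q j φ) := by
  induction j generalizing φ with
  | zero =>
    exact ⟨fun h => hP₀ _ (mem_sigmaClass_zero.1 h), fun h => hQ₀ _ (mem_piClass_zero.1 h)⟩
  | succ j ih =>
    constructor
    · intro h
      induction φ with
      | ex φ ihφ =>
        obtain ⟨ψ, e, h | h⟩ := mem_sigmaClass_succ.1 h <;> cases e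
        · exact hP _ _ (.inl ⟨h, ihφ h⟩)
        · exact hP _ _ (.inr ⟨h, (ih φ).2 h⟩)
      | _ => obtain ⟨ψ, e, -⟩ := mem_sigmaClass_succ.1 h; cases e
    · intro h
      induction φ with
      | all φ ihφ =>
        obtain ⟨ψ, e, h | h⟩ := mem_piClass_succ.1 h <;> cases e
        · exact hQ _ _ (.inl ⟨h, ihφ h⟩)
        · exact hQ _ _ (.inr ⟨h, (ih φ).1 h⟩)
      | _ => obtain ⟨ψ, e, -⟩ := mem_piClass_succ.1 h; cases e

theorem Fml.IsQF.subst {φ : Fml} (h : φ.IsQF) (σ : ℕ → Tm) : (φ.subst σ).IsQF := by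
  induction φ with
  | bot | eq => trivial
  | and φ ψ h₁ h₂ | or φ ψ h₁ h₂ | imp φ ψ h₁ h₂ => exact ⟨h₁ h.1, h₂ h.2⟩
  | all φ | ex φ => exact h.elim

theorem prenex_subst (j : ℕ) (φ : Fml) :
    (φ ∈ SigmaClass j → ∀ σ, φ.subst σ ∈ SigmaClass j) ∧
      (φ ∈ PiClass j → ∀ σ, φ.subst σ ∈ PiClass j) := by
  refine prenex_induction (P := fun j φ => ∀ σ, φ.subst σ ∈ SigmaClass j)
    (Q := fun j φ => ∀ σ, φ.subst σ ∈ PiClass j) ?_ ?_ ?_ ?_ j φ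
  · exact fun φ h σ => mem_sigmaClass_zero.2 (h.subst σ)
  · exact fun φ h σ => mem_piClass_zero.2 (h.subst σ)
  · rintro j φ h σ
    exact mem_sigmaClass_succ.2 ⟨_, rfl, h.imp (fun h => h.2 _) fun h => h.2 _⟩
  · rintro j φ h σ
    exact mem_piClass_succ.2 ⟨_, rfl, h.imp (fun h => h.2 _) fun h => h.2 _⟩

/-- `φ` is `T`-equivalent to a formula of the class with the same free variables. -/
def Rep (T : Set Fml) (C : Set Fml) (φ : Fml) : Prop := ∃ ψ ∈ C, φ.fv = ψ.fv ∧ Eqv T φ ψ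

abbrev RSig (T : Set Fml) (j : ℕ) : Fml → Prop := Rep T (SigmaClass j)
abbrev RPi (T : Set Fml) (j : ℕ) : Fml → Prop := Rep T (PiClass j)

theorem Rep.of_mem {T C : Set Fml} {φ : Fml} (h : φ ∈ C) : Rep T C φ := ⟨φ, h, rfl, .refl _⟩

theorem Rep.congr {T C : Set Fml} {φ ψ : Fml} (h : Rep T C ψ) (e : Eqv T φ ψ)
    (hfv : φ.fv = ψ.fv) : Rep T C φ := by
  obtain ⟨χ, hχ, h₁, h₂⟩ := h
  exact ⟨χ, hχ, hfv.trans h₁, e.trans h₂⟩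

theorem fv_ex_congr {φ ψ : Fml} (h : φ.fv = ψ.fv) : φ.ex.fv = ψ.ex.fv := by simp [Fml.fv, h]
theorem fv_all_congr {φ ψ : Fml} (h : φ.fv = ψ.fv) : φ.all.fv = ψ.all.fv := by simp [Fml.fv, h]
@[simp] theorem fv_neg (φ : Fml) : φ.neg.fv = φ.fv := by simp [Fml.neg, Fml.fv]
theorem fv_subst_congr {φ ψ : Fml} (h : φ.fv = ψ.fv) (σ : ℕ → Tm) :
    (φ.subst σ).fv = (ψ.subst σ).fv := by
  ext n; simp [Fml.mem_fv_subst, h]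

-- Closure properties of the prenex classes

section

variable {T : Set Fml} (hT : ArithTheory T)
include hT

theorem RSig.subst {j : ℕ} {φ : Fml} (h : RSig T j φ) (σ : ℕ → Tm) : RSig T j (φ.subst σ) := by
  obtain ⟨ψ, hψ, h₁, h₂⟩ := h
  exact ⟨_, (prenex_subst j ψ).1 hψ σ, fv_subst_congr h₁ σ, h₂.subst hT.substClosed σ⟩

theorem RPi.subst {j : ℕ} {φ : Fml} (h : RPi T j φ) (σ : ℕ → Tm) : RPi T j (φ.subst σ) := by
  obtain ⟨ψ, hψ, h₁, h₂⟩ := h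
  exact ⟨_, (prenex_subst j ψ).2 hψ σ, fv_subst_congr h₁ σ, h₂.subst hT.substClosed σ⟩

theorem RSig.inst {j : ℕ} {φ : Fml} (h : RSig T j φ) (t : Tm) : RSig T j (φ.inst t) :=
  RSig.subst hT h _

theorem RPi.inst {j : ℕ} {φ : Fml} (h : RPi T j φ) (t : Tm) : RPi T j (φ.inst t) :=
  RPi.subst hT h _

theorem RSig.ex {j : ℕ} {φ : Fml} (h : RSig T (j + 1) φ) : RSig T (j + 1) φ.ex := by
  obtain ⟨ψ, hψ, h₁, h₂⟩ := h
  exact ⟨ψ.ex, mem_sigmaClass_succ.2 ⟨ψ, rfl, .inl hψ⟩, fv_ex_congr h₁, h₂.ex hT.substClosed⟩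

theorem RPi.all {j : ℕ} {φ : Fml} (h : RPi T (j + 1) φ) : RPi T (j + 1) φ.all := by
  obtain ⟨ψ, hψ, h₁, h₂⟩ := h
  exact ⟨ψ.all, mem_piClass_succ.2 ⟨ψ, rfl, .inl hψ⟩, fv_all_congr h₁, h₂.all hT.substClosed⟩

/-- A dummy quantifier is added. The blocks of the hierarchy are nonempty, so the inclusions between
its levels hold only up to equivalence. -/
theorem RPi.toSig {j : ℕ} {φ : Fml} (h : RPi T j φ) : RSig T (j + 1) φ := by
  obtain ⟨ψ, hψ, h₁, h₂⟩ := RPi.subst hT h sshift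
  refine Rep.congr ⟨ψ.ex, mem_sigmaClass_succ.2 ⟨ψ, rfl, .inr hψ⟩, rfl, .refl _⟩
    (.trans (fun Γ => ⟨fun d => .exI zeroT (by rwa [← Fml.shift_eq, Fml.shift_inst]), fun d =>
      .exE_inst hT.substClosed d fun t => ?_⟩) (h₂.ex hT.substClosed))
    (.trans ?_ (fv_ex_congr h₁))
  · rw [← Fml.shift_eq, Fml.shift_inst]
    exact .hyp0
  · ext n
    exact Fml.succ_mem_fv_shift.symm

theorem RSig.toPi {j : ℕ} {φ : Fml} (h : RSig T j φ) : RPi T (j + 1) φ := by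
  obtain ⟨ψ, hψ, h₁, h₂⟩ := RSig.subst hT h sshift
  refine Rep.congr ⟨ψ.all, mem_piClass_succ.2 ⟨ψ, rfl, .inr hψ⟩, rfl, .refl _⟩
    (.trans (fun Γ => ⟨fun d => .allI_inst hT.substClosed fun t => ?_, fun d => ?_⟩)
      (h₂.all hT.substClosed))
    (.trans ?_ (fv_all_congr h₁))
  · rwa [← Fml.shift_eq, Fml.shift_inst]
  · have := Derives.allE zeroT d
    rwa [← Fml.shift_eq, Fml.shift_inst] at this
  · ext n
    exact Fml.succ_mem_fv_shift.symm

theorem RSig.induction {j : ℕ} {P : Fml → Prop}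
    (hP : ∀ φ ψ, Eqv T φ ψ → φ.fv = ψ.fv → P ψ → P φ) (base : ∀ φ, RPi T j φ → P φ)
    (step : ∀ φ, RSig T (j + 1) φ → P φ → P φ.ex) {φ : Fml} (h : RSig T (j + 1) φ) : P φ := by
  obtain ⟨ψ, hψ, h₁, h₂⟩ := h
  refine hP _ _ h₂ h₁ ?_
  clear h₁ h₂
  induction ψ with
  | ex ψ ih =>
    obtain ⟨χ, e, h | h⟩ := mem_sigmaClass_succ.1 hψ <;> cases e
    · exact step _ (.of_mem h) (ih h)
    · exact step _ (RPi.toSig hT (.of_mem h)) (base _ (.of_mem h))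
  | _ => obtain ⟨ψ, e, -⟩ := mem_sigmaClass_succ.1 hψ; cases e

theorem RPi.induction {j : ℕ} {P : Fml → Prop}
    (hP : ∀ φ ψ, Eqv T φ ψ → φ.fv = ψ.fv → P ψ → P φ) (base : ∀ φ, RSig T j φ → P φ)
    (step : ∀ φ, RPi T (j + 1) φ → P φ → P φ.all) {φ : Fml} (h : RPi T (j + 1) φ) : P φ := by
  obtain ⟨ψ, hψ, h₁, h₂⟩ := h
  refine hP _ _ h₂ h₁ ?_
  clear h₁ h₂
  induction ψ with
  | all ψ ih =>
    obtain ⟨χ, e, h | h⟩ := mem_piClass_succ.1 hψ <;> cases e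
    · exact step _ (.of_mem h) (ih h)
    · exact step _ (RSig.toPi hT (.of_mem h)) (base _ (.of_mem h))
  | _ => obtain ⟨ψ, e, -⟩ := mem_piClass_succ.1 hψ; cases e

theorem RSig.succ_and_RPi_succ (j : ℕ) (φ : Fml) :
    (RSig T j φ → RSig T (j + 1) φ) ∧ (RPi T j φ → RPi T (j + 1) φ) := by
  induction j generalizing φ with
  | zero =>
    have e : SigmaClass 0 = PiClass 0 := by ext; rw [mem_sigmaClass_zero, mem_piClass_zero]
    constructor
    · intro h; rw [RSig, e] at h; exact RPi.toSig hT h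
    · intro h; rw [RPi, ← e] at h; exact RSig.toPi hT h
  | succ j ih =>
    constructor
    · refine RSig.induction hT (fun _ _ e hfv h => h.congr e hfv) (fun φ h => ?_)
        fun φ _ h => RSig.ex hT h
      exact RPi.toSig hT ((ih φ).2 h)
    · refine RPi.induction hT (fun _ _ e hfv h => h.congr e hfv) (fun φ h => ?_)
        fun φ _ h => RPi.all hT h
      exact RSig.toPi hT ((ih φ).1 h)

theorem RSig.mono {i j : ℕ} (hij : i ≤ j) {φ : Fml} (h : RSig T i φ) : RSig T j φ := by
  induction hij with
  | refl => exact h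
  | step _ ih => exact (RSig.succ_and_RPi_succ hT _ _).1 ih

theorem RPi.mono {i j : ℕ} (hij : i ≤ j) {φ : Fml} (h : RPi T i φ) : RPi T j φ := by
  induction hij with
  | refl => exact h
  | step _ ih => exact (RSig.succ_and_RPi_succ hT _ _).2 ih

omit hT in
theorem RSig.of_isQF {φ : Fml} (h : φ.IsQF) : RSig T 0 φ := .of_mem (mem_sigmaClass_zero.2 h)

omit hT in
theorem RPi.of_isQF {φ : Fml} (h : φ.IsQF) : RPi T 0 φ := .of_mem (mem_piClass_zero.2 h)

omit hT in
theorem RSig.zero_iff_RPi {φ : Fml} : RSig T 0 φ ↔ RPi T 0 φ := by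
  have e : SigmaClass 0 = PiClass 0 := by ext; rw [mem_sigmaClass_zero, mem_piClass_zero]
  rw [RSig, RPi, e]

/-- A binary operation that commutes with `∃` in both arguments. -/
theorem RSig.binop {j : ℕ} {op : Fml → Fml → Fml}
    (hcongr : ∀ φ φ' χ χ', Eqv T φ φ' → Eqv T χ χ' → Eqv T (op φ χ) (op φ' χ'))
    (hfv : ∀ φ χ, (op φ χ).fv = φ.fv ∪ χ.fv)
    (hl : ∀ φ χ, Eqv T (op φ.ex χ) (op φ χ.shift).ex)
    (hr : ∀ φ χ, Eqv T (op φ χ.ex) (op φ.shift χ).ex)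
    (base : ∀ φ χ, RPi T j φ → RPi T j χ → RSig T (j + 1) (op φ χ)) {φ χ : Fml}
    (hφ : RSig T (j + 1) φ) (hχ : RSig T (j + 1) χ) : RSig T (j + 1) (op φ χ) := by
  refine RSig.induction hT (P := fun φ => ∀ χ, RSig T (j + 1) χ → RSig T (j + 1) (op φ χ))
    ?_ ?_ ?_ hφ χ hχ
  · exact fun φ ψ e h ih χ hχ => (ih χ hχ).congr (hcongr _ _ _ _ e (.refl _)) (by simp [hfv, h])
  · intro φ hφ χ hχ
    refine RSig.induction hT (P := fun χ => ∀ φ, RPi T j φ → RSig T (j + 1) (op φ χ))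
      ?_ ?_ ?_ hχ φ hφ
    · exact fun χ ψ e h ih φ hφ => (ih φ hφ).congr (hcongr _ _ _ _ (.refl _) e) (by simp [hfv, h])
    · exact fun χ hχ φ hφ => base φ χ hφ hχ
    · intro χ _ ih φ hφ
      refine Rep.congr (RSig.ex hT (ih φ.shift (RPi.subst hT hφ _))) (hr φ χ) ?_
      ext n
      simp [Fml.fv, hfv]
  · intro φ _ ih χ hχ
    refine Rep.congr (RSig.ex hT (ih χ.shift (RSig.subst hT hχ _))) (hl φ χ) ?_
    ext n
    simp [Fml.fv, hfv]

/-- A binary operation that commutes with `∀` in both arguments. -/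
theorem RPi.binop {j : ℕ} {op : Fml → Fml → Fml}
    (hcongr : ∀ φ φ' χ χ', Eqv T φ φ' → Eqv T χ χ' → Eqv T (op φ χ) (op φ' χ'))
    (hfv : ∀ φ χ, (op φ χ).fv = φ.fv ∪ χ.fv)
    (hl : ∀ φ χ, RPi T (j + 1) φ → Eqv T (op φ.all χ) (op φ χ.shift).all)
    (hr : ∀ φ χ, RPi T (j + 1) χ → Eqv T (op φ χ.all) (op φ.shift χ).all)
    (base : ∀ φ χ, RSig T j φ → RSig T j χ → RPi T (j + 1) (op φ χ)) {φ χ : Fml}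
    (hφ : RPi T (j + 1) φ) (hχ : RPi T (j + 1) χ) : RPi T (j + 1) (op φ χ) := by
  refine RPi.induction hT (P := fun φ => ∀ χ, RPi T (j + 1) χ → RPi T (j + 1) (op φ χ))
    ?_ ?_ ?_ hφ χ hχ
  · exact fun φ ψ e h ih χ hχ => (ih χ hχ).congr (hcongr _ _ _ _ e (.refl _)) (by simp [hfv, h])
  · intro φ hφ χ hχ
    refine RPi.induction hT (P := fun χ => ∀ φ, RSig T j φ → RPi T (j + 1) (op φ χ))
      ?_ ?_ ?_ hχ φ hφ
    · exact fun χ ψ e h ih φ hφ => (ih φ hφ).congr (hcongr _ _ _ _ (.refl _) e) (by simp [hfv, h])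
    · exact fun χ hχ φ hφ => base φ χ hφ hχ
    · intro χ h ih φ hφ
      refine Rep.congr (RPi.all hT (ih φ.shift (RSig.subst hT hφ _))) (hr φ χ h) ?_
      ext n
      simp [Fml.fv, hfv]
  · intro φ h ih χ hχ
    refine Rep.congr (RPi.all hT (ih χ.shift (RPi.subst hT hχ _))) (hl φ χ h) ?_
    ext n
    simp [Fml.fv, hfv]

theorem RSig.and_and_RPi_and (j : ℕ) (φ χ : Fml) :
    (RSig T j φ → RSig T j χ → RSig T j (φ.and χ)) ∧
      (RPi T j φ → RPi T j χ → RPi T j (φ.and χ)) := by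
  have hs := hT.substClosed
  induction j generalizing φ χ with
  | zero =>
    have key : RSig T 0 φ → RSig T 0 χ → RSig T 0 (φ.and χ) := by
      rintro ⟨φ', h, h₁, h₂⟩ ⟨χ', h', h₁', h₂'⟩
      rw [mem_sigmaClass_zero] at h h'
      exact ⟨φ'.and χ', mem_sigmaClass_zero.2 ⟨h, h'⟩, by simp [Fml.fv, h₁, h₁'], h₂.and h₂'⟩
    exact ⟨key, by simpa only [RSig.zero_iff_RPi] using key⟩
  | succ j ih =>
    constructor
    · refine RSig.binop hT (fun _ _ _ _ => Eqv.and) (fun _ _ => rfl) (fun φ χ Γ => ?_)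
        (fun φ χ Γ => ?_) fun φ χ h h' => RPi.toSig hT ((ih φ χ).2 h h')
      · refine ⟨fun d => .exE_inst hs d.andEl fun t => .exI t ?_,
          fun d => .exE_inst hs d fun t => ?_⟩
        · simpa using .andI .hyp0 d.andEr.wk
        · simpa using .andI (.exI t (Derives.andEl .hyp0)) (Derives.andEr .hyp0)
      · refine ⟨fun d => .exE_inst hs d.andEr fun t => .exI t ?_,
          fun d => .exE_inst hs d fun t => ?_⟩
        · simpa using .andI d.andEl.wk .hyp0
        · simpa using .andI (Derives.andEl .hyp0) (.exI t (Derives.andEr .hyp0))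
    · refine RPi.binop hT (fun _ _ _ _ => Eqv.and) (fun _ _ => rfl) (fun φ χ _ Γ => ?_)
        (fun φ χ _ Γ => ?_) fun φ χ h h' => RSig.toPi hT ((ih φ χ).1 h h')
      · simp only [Derives.and_iff, Derives.all_iff hs, Fml.inst_and, Fml.shift_inst]
        exact ⟨fun h t => ⟨h.1 t, h.2⟩, fun h => ⟨fun t => (h t).1, (h zeroT).2⟩⟩
      · simp only [Derives.and_iff, Derives.all_iff hs, Fml.inst_and, Fml.shift_inst]
        exact ⟨fun h t => ⟨h.1, h.2 t⟩, fun h => ⟨(h zeroT).1, fun t => (h t).2⟩⟩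

theorem RSig.and {j : ℕ} {φ χ : Fml} (h : RSig T j φ) (h' : RSig T j χ) : RSig T j (φ.and χ) :=
  (RSig.and_and_RPi_and hT j φ χ).1 h h'

theorem RPi.and {j : ℕ} {φ χ : Fml} (h : RPi T j φ) (h' : RPi T j χ) : RPi T j (φ.and χ) :=
  (RSig.and_and_RPi_and hT j φ χ).2 h h'

/-- Moving `∃` out of the conclusion is not intuitionistic in general, but α is decidable: if it
fails, any witness will do, and 0 is taken. -/
theorem RSig.imp_and_RPi_imp (j : ℕ) (α φ : Fml) (hα : α.IsQF) :
    (RSig T j φ → RSig T j (α.imp φ)) ∧ (RPi T j φ → RPi T j (α.imp φ)) := by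
  have hs := hT.substClosed
  induction j generalizing φ α with
  | zero =>
    have key : RSig T 0 φ → RSig T 0 (α.imp φ) := by
      rintro ⟨φ', h, h₁, h₂⟩
      rw [mem_sigmaClass_zero] at h
      exact ⟨α.imp φ', mem_sigmaClass_zero.2 ⟨hα, h⟩, by simp [Fml.fv, h₁], .imp (.refl _) h₂⟩
    exact ⟨key, by simpa only [RSig.zero_iff_RPi] using key⟩
  | succ j ih =>
    constructor
    · intro h
      refine RSig.induction hT (P := fun φ => ∀ α : Fml, α.IsQF → RSig T (j + 1) (α.imp φ))
        ?_ ?_ ?_ h α hα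
      · exact fun φ ψ e h ih α hα => (ih α hα).congr (.imp (.refl _) e) (by simp [Fml.fv, h])
      · exact fun φ h α hα => RPi.toSig hT ((ih α φ hα).2 h)
      · intro φ _ ih α hα
        refine Rep.congr (RSig.ex hT (ih α.shift (hα.subst _)))
          (fun Γ => ⟨fun d => ?_, fun d => ?_⟩) ?_
        · refine .orE (hT.qf_em hα) (.exE_inst hs (.impE d.wk .hyp0) fun t => .exI t ?_) ?_
          · simpa using .impI .hyp1
          · exact .exI zeroT (by simpa using .impI (.negE .hyp1 .hyp0))
        · refine .exE_inst hs d fun t => .impI (.exI t (.impE (φ := α) ?_ .hyp0))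
          simpa using .hyp1
        · ext n
          simp [Fml.fv]
    · intro h
      refine RPi.induction hT (P := fun φ => ∀ α : Fml, α.IsQF → RPi T (j + 1) (α.imp φ))
        ?_ ?_ ?_ h α hα
      · exact fun φ ψ e h ih α hα => (ih α hα).congr (.imp (.refl _) e) (by simp [Fml.fv, h])
      · exact fun φ h α hα => RSig.toPi hT ((ih α φ hα).1 h)
      · intro φ _ ih α hα
        refine Rep.congr (RPi.all hT (ih α.shift (hα.subst _))) (fun Γ => ?_) ?_
        · simp [Derives.all_iff hs, Derives.imp_iff]
        · ext n
          simp [Fml.fv]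

/-- A disjunction is coded by the choice of a number: `∃x ((x = 0 → φ) ∧ (x ≠ 0 → χ))`. This avoids
distributing `∨` over the inner universal quantifiers, which would need classical logic. -/
theorem RSig.or {j : ℕ} {φ χ : Fml} (h : RSig T j φ) (h' : RSig T j χ) : RSig T j (φ.or χ) := by
  have hs := hT.substClosed
  cases j with
  | zero =>
    obtain ⟨φ', h, h₁, h₂⟩ := h
    obtain ⟨χ', h', h₁', h₂'⟩ := h'
    rw [mem_sigmaClass_zero] at h h'
    exact ⟨φ'.or χ', mem_sigmaClass_zero.2 ⟨h, h'⟩, by simp [Fml.fv, h₁, h₁'], h₂.or h₂'⟩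
  | succ j =>
    have hα : (Fml.eq (.var 0) zeroT).IsQF := trivial
    have hα' : (Fml.eq (.var 0) zeroT).neg.IsQF := ⟨trivial, trivial⟩
    have e : ∀ t, ((((Fml.eq (.var 0) zeroT).imp φ.shift).and
        ((Fml.eq (.var 0) zeroT).neg.imp χ.shift)).inst t) =
        ((Fml.eq t zeroT).imp φ).and ((Fml.eq t zeroT).neg.imp χ) := fun t => by
      simp only [Fml.inst_and, Fml.inst_imp, Fml.inst_neg, Fml.shift_inst]
      simp only [Fml.inst_eq, Fml.subst, Language.Term.subst, scons_zero, zeroT_subst]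
    refine Rep.congr (RSig.ex hT (RSig.and hT
      ((RSig.imp_and_RPi_imp hT _ _ φ.shift hα).1 (RSig.subst hT h _))
      ((RSig.imp_and_RPi_imp hT _ _ χ.shift hα').1 (RSig.subst hT h' _))))
      (fun Γ => ⟨fun d => .orE d (.exI zeroT ?_) (.exI (succT zeroT) ?_),
        fun d => .exE_inst hs d fun t => ?_⟩) ?_
    · rw [e]
      exact .andI (.impI .hyp1) (.impI (.negE .hyp0 (hT.eq_refl _)))
    · rw [e]
      exact .andI (.impI (hT.succ_ne_zero .hyp0)) (.impI .hyp1)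
    · rw [e]
      refine .orE (hT.eq_em t zeroT) ?_ ?_
      · exact .orIl (.impE (Derives.andEl .hyp1) .hyp0)
      · exact .orIr (.impE (Derives.andEr .hyp1) .hyp0)
    · ext n
      simp [Fml.fv, Fml.neg, zeroT, mkApp]

end

/-! ### Stable and decidable formulas -/

/-- `T` proves `¬ ¬ φ → φ`. -/
def Stable (T : Set Fml) (φ : Fml) : Prop := ∀ Γ, Derives T Γ φ.neg.neg → Derives T Γ φ

/-- `T` proves `φ ∨ ¬ φ`. -/
def Dec (T : Set Fml) (φ : Fml) : Prop := ∀ Γ, Derives T Γ (φ.or φ.neg)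

theorem Dec.stable {T : Set Fml} {φ : Fml} (h : Dec T φ) : Stable T φ := fun Γ d =>
  .orE (h Γ) .hyp0 (.negE d.wk .hyp0)

theorem Stable.subst {T : Set Fml} (hT : SubstClosed T) {φ : Fml} (h : Stable T φ) (σ : ℕ → Tm) :
    Stable T (φ.subst σ) := fun _ d =>
  d.cut (((h [φ.neg.neg] .hyp0).subst hT σ).weaken (by simp))

theorem Dec.subst {T : Set Fml} (hT : SubstClosed T) {φ : Fml} (h : Dec T φ) (σ : ℕ → Tm) :
    Dec T (φ.subst σ) := fun _ => ((h []).subst hT σ).weaken (by simp)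

theorem Stable.congr {T : Set Fml} {φ ψ : Fml} (h : Stable T ψ) (e : Eqv T φ ψ) : Stable T φ :=
  fun Γ d => (e Γ).2 (h Γ ((e.neg.neg Γ).1 d))

theorem Dec.congr {T : Set Fml} {φ ψ : Fml} (h : Dec T ψ) (e : Eqv T φ ψ) : Dec T φ :=
  fun Γ => ((e.or e.neg) Γ).2 (h Γ)

theorem Stable.eqv {T : Set Fml} {φ : Fml} (h : Stable T φ) : Eqv T φ.neg.neg φ := fun Γ =>
  ⟨h Γ, .dnI⟩

theorem Stable.all {T : Set Fml} (hT : SubstClosed T) {φ : Fml} (h : Stable T φ) :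
    Stable T φ.all := fun _ d =>
  .allI_inst hT fun t => (h.subst hT _) _ (d.dn_map (.allE t .hyp0))

section

variable {T : Set Fml} (hT : ArithTheory T)
include hT

/-! ### Merging two parameters into one -/

/-- Replaces the parameters `0` and `1` by the components of a pair. -/
def mergeSubst : ℕ → Tm :=
  scons (.var 1) (scons (.var 0) (scomp sshift (scomp sshift sshift)))

/-- The substitution of a pair for the merged parameter. -/
def pairSubst : ℕ → Tm := scons (pairT (.var 0) (.var 1)) (scomp sshift sshift)

/-- Index 2 is the merged parameter and indices 1 and 0 are its components, for the former
parameters 0 and 1. The other parameters drop by one through the merging and rise by two through the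
binders. -/
def mergeExBody (φ : Fml) : Fml :=
  (Fml.eq (pairT (.var 1) (.var 0)) (.var 2)).and (φ.subst mergeSubst)

def mergeAllBody (φ : Fml) : Fml :=
  (Fml.eq (pairT (.var 1) (.var 0)) (.var 2)).imp (φ.subst mergeSubst)

def mergeEx (φ : Fml) : Fml := (mergeExBody φ).ex.ex

def mergeAll (φ : Fml) : Fml := (mergeAllBody φ).all.all

omit hT in
theorem scons_scons_sshift :
    scons (Language.Term.var 0) (scons (Language.Term.var 1) (scomp sshift sshift)) = sid := by
  funext n
  rcases n with _ | _ | n <;> rfl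

omit hT in
theorem mergeExBody_inst (φ : Fml) (t u : Tm) :
    (((mergeExBody φ).subst (liftSubst (liftSubst pairSubst))).subst
      (liftSubst (scons t sid))).inst u =
      (Fml.eq (pairT t u) (pairT (.var 0) (.var 1))).and
        (φ.subst (scons t (scons u (scomp sshift sshift)))) := by
  simp [mergeExBody, Fml.inst_eq, Fml.subst, mergeSubst, liftSubst_eq, pairSubst,
    Language.Term.subst]

omit hT in
theorem mergeAllBody_inst (φ : Fml) (t u : Tm) :
    (((mergeAllBody φ).subst (liftSubst (liftSubst pairSubst))).subst
      (liftSubst (scons t sid))).inst u =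
      (Fml.eq (pairT t u) (pairT (.var 0) (.var 1))).imp
        (φ.subst (scons t (scons u (scomp sshift sshift)))) := by
  simp [mergeAllBody, Fml.inst_eq, Fml.subst, mergeSubst, liftSubst_eq, pairSubst,
    Language.Term.subst]

theorem subst_of_pair_eq {Γ : List Fml} {φ : Fml} {t u : Tm}
    (h : Derives T Γ (Fml.eq (pairT t u) (pairT (.var 0) (.var 1)))) :
    Derives T Γ (φ.subst (scons t (scons u (scomp sshift sshift)))) ↔ Derives T Γ φ := by
  obtain ⟨h₁, h₂⟩ := hT.pair_inj h
  have e : φ = φ.subst (scons (.var 0) (scons (.var 1) (scomp sshift sshift))) := by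
    rw [scons_scons_sshift, Fml.subst_sid]
  conv_rhs => rw [e]
  constructor <;> refine hT.subst_congr φ fun n => ?_ <;> rcases n with _ | _ | n
  · exact h₁
  · exact h₂
  · exact hT.eq_refl _
  · exact hT.eq_symm h₁
  · exact hT.eq_symm h₂
  · exact hT.eq_refl _

/-- By injectivity of pairing, the only components of the pair `(x, y)` are x and y, so the
quantified copy of φ is φ itself. -/
theorem mergeEx_eqv (φ : Fml) : Eqv T ((mergeEx φ).subst pairSubst) φ := by
  have hs := hT.substClosed
  refine fun Γ => ⟨fun d => .exE_inst hs d fun t => ?_, fun d => .exI (.var 0) ?_⟩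
  · rw [Fml.inst_eq _ t]
    refine .exE_inst hs .hyp0 fun u => ?_
    rw [mergeExBody_inst]
    exact (subst_of_pair_eq hT (Derives.andEl .hyp0)).1 (Derives.andEr .hyp0)
  · rw [Fml.inst_eq]
    refine .exI (.var 1) ?_
    rw [mergeExBody_inst, scons_scons_sshift, Fml.subst_sid]
    exact .andI (hT.eq_refl _) d

theorem mergeAll_eqv (φ : Fml) : Eqv T ((mergeAll φ).subst pairSubst) φ := by
  have hs := hT.substClosed
  refine fun Γ => ⟨fun d => ?_, fun d => .allI_inst hs fun t => ?_⟩
  · have d' := d.allE (.var 0)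
    rw [Fml.inst_eq] at d'
    have d' := d'.allE (.var 1)
    rw [mergeAllBody_inst, scons_scons_sshift, Fml.subst_sid] at d'
    exact .impE d' (hT.eq_refl _)
  · rw [Fml.inst_eq _ t]
    refine .allI_inst hs fun u => ?_
    rw [mergeAllBody_inst]
    exact .impI ((subst_of_pair_eq hT .hyp0).2 d.wk)

omit hT in
theorem fv_merge {φ : Fml} {n : ℕ} (h : ∀ i ∈ φ.fv, i < n + 2) :
    (∀ i ∈ (mergeEx φ).fv, i < n + 1) ∧ ∀ i ∈ (mergeAll φ).fv, i < n + 1 := by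
  have key : ∀ i, i + 2 ∈ (Fml.eq (pairT (.var 1) (.var 0)) (.var 2)).fv ∪ (φ.subst mergeSubst).fv →
      i < n + 1 := by
    rintro i (hi | hi)
    · simp [Fml.mem_fv_eq, pairT, mkApp] at hi
      omega
    · obtain ⟨m, hm, hi⟩ := Fml.mem_fv_subst.1 hi
      have := h m hm
      rcases m with _ | _ | m <;>
        simp [mergeSubst, scomp_apply, Language.Term.subst] at hi
      omega
  exact ⟨key, key⟩

/-- The schema has a single parameter. Further ones are absorbed by pairing, which lowers the bound
on the free variables by one and stays in `Σ_m`. For m = 0 the merged formula would not be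
quantifier-free, but decidability applies directly. -/
theorem stable_of_DNE {m : ℕ} (h : DNE (SigmaClass m) ⊆ T) {φ : Fml} (hφ : RSig T m φ) :
    Stable T φ := by
  cases m with
  | zero =>
    obtain ⟨ψ, hψ, -, e⟩ := hφ
    exact Stable.congr (Dec.stable fun _ => hT.qf_em (mem_sigmaClass_zero.1 hψ)) e
  | succ m =>
    obtain ⟨n, hn⟩ := φ.fv_bddAbove
    replace hn : ∀ i ∈ φ.fv, i < n + 1 := fun i hi => (hn i hi).trans n.lt_succ_self
    induction n generalizing φ with
    | zero =>
      obtain ⟨ψ, hψ, hfv, e⟩ := hφ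
      refine Stable.congr (fun Γ d => .impE ?_ d) e
      -- Only the variable 0 can be free in `ψ`, so instantiating the axiom at it reproduces `ψ`.
      have := Derives.allE (T := T) (Γ := Γ) (.var 0) (.ax (h ⟨ψ, hψ, fun i hi => ?_, rfl⟩))
      · rw [Fml.inst_eq] at this
        rwa [Fml.subst_congr (τ := sid), Fml.subst_sid] at this
        intro i hi
        have := hn i (by simpa [Fml.fv, hfv] using hi)
        obtain rfl : i = 0 := by omega
        rfl
      · have := hn i (hfv ▸ hi)
        simp; omega
    | succ n ih =>
      refine Stable.congr (Stable.subst hT.substClosed (ih (φ := mergeEx φ) ?_ (fv_merge hn).1) _)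
        (mergeEx_eqv hT φ).symm
      exact RSig.ex hT (RSig.ex hT (RSig.and hT (RSig.mono hT (Nat.zero_le _)
        (RSig.of_isQF trivial)) (RSig.subst hT hφ _)))

theorem dec_of_LEM {m : ℕ} (h : LEM (PiClass m) ⊆ T) {φ : Fml} (hφ : RPi T m φ) :
    Dec T φ := by
  cases m with
  | zero =>
    obtain ⟨ψ, hψ, -, e⟩ := hφ
    exact Dec.congr (fun _ => hT.qf_em (mem_piClass_zero.1 hψ)) e
  | succ m =>
    obtain ⟨n, hn⟩ := φ.fv_bddAbove
    replace hn : ∀ i ∈ φ.fv, i < n + 1 := fun i hi => (hn i hi).trans n.lt_succ_self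
    induction n generalizing φ with
    | zero =>
      obtain ⟨ψ, hψ, hfv, e⟩ := hφ
      refine Dec.congr (fun Γ => ?_) e
      have := Derives.allE (T := T) (Γ := Γ) (.var 0) (.ax (h ⟨ψ, hψ, fun i hi => ?_, rfl⟩))
      · rw [Fml.inst_eq] at this
        rwa [Fml.subst_congr (τ := sid), Fml.subst_sid] at this
        intro i hi
        have := hn i (by simpa [Fml.fv, hfv] using hi)
        obtain rfl : i = 0 := by omega
        rfl
      · have := hn i (hfv ▸ hi)
        simp; omega
    | succ n ih =>
      refine Dec.congr (Dec.subst hT.substClosed (ih (φ := mergeAll φ) ?_ (fv_merge hn).2) _)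
        (mergeAll_eqv hT φ).symm
      have hα : (Fml.eq (pairT (.var 1) (.var 0)) (.var 2)).IsQF := trivial
      exact RPi.all hT (RPi.all hT ((RSig.imp_and_RPi_imp hT _ _ _ hα).2
        (RPi.subst hT hφ _)))

/-! ### Prenexing with double negation elimination for `Σ_m` -/

variable {m : ℕ} (hD : ∀ φ, RSig T m φ → Stable T φ)
include hD

theorem RSig.stable {j : ℕ} (hj : j ≤ m) {φ : Fml} (h : RSig T j φ) : Stable T φ :=
  hD φ (RSig.mono hT hj h)

theorem RPi.stable {j : ℕ} (hj : j ≤ m + 1) {φ : Fml} (h : RPi T j φ) : Stable T φ := by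
  refine RPi.induction (j := m) hT (P := Stable T) ?_ hD ?_ (RPi.mono hT hj h)
  · exact fun φ ψ e _ h => h.congr e
  · exact fun φ _ h => h.all hT.substClosed

theorem RPi.not_all_eqv {j : ℕ} (hj : j ≤ m + 1) {φ : Fml} (h : RPi T j φ)
    (h' : Stable T φ.neg.ex) : Eqv T φ.all.neg φ.neg.ex := by
  have hs := hT.substClosed
  refine fun Γ => ⟨fun d => h' _ (.negI (.negE d.wk (.allI_inst hs fun t => ?_))), fun d => ?_⟩
  · exact RPi.stable hT hD hj (RPi.inst hT h t) _ (.negI (.negE .hyp1 (.exI t .hyp0)))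
  · exact .negI (.exE_inst hs d.wk fun t => .negE .hyp0 (.allE t .hyp1))

/-- The bounds differ because `¬∃` is always `∀¬`, whereas turning `¬∀` into `∃¬` needs the
resulting `Σ_j` formula to be stable, that is, j ≤ m. -/
theorem prenex_neg (j : ℕ) (φ : Fml) :
    (j ≤ m → RPi T j φ → RSig T j φ.neg) ∧ (j ≤ m + 1 → RSig T j φ → RPi T j φ.neg) := by
  induction j generalizing φ with
  | zero =>
    have key : RSig T 0 φ → RSig T 0 φ.neg := by
      rintro ⟨ψ, hψ, h₁, h₂⟩
      rw [mem_sigmaClass_zero] at hψ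
      exact ⟨ψ.neg, mem_sigmaClass_zero.2 ⟨hψ, trivial⟩, by simp [h₁], h₂.neg⟩
    exact ⟨fun _ h => key (RSig.zero_iff_RPi.2 h), fun _ h => RSig.zero_iff_RPi.1 (key h)⟩
  | succ j ih =>
    constructor
    · intro hj
      refine RPi.induction hT (P := fun φ => RSig T (j + 1) φ.neg) ?_ ?_ ?_
      · exact fun φ ψ e hfv h => h.congr e.neg (by simp [hfv])
      · exact fun φ h => RPi.toSig hT ((ih φ).2 (by omega) h)
      · intro φ h h'
        have := RSig.ex hT h'
        exact this.congr (RPi.not_all_eqv hT hD (by omega) h (RSig.stable hT hD hj this))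
          (by simp [Fml.fv])
    · intro hj
      refine RSig.induction hT (P := fun φ => RPi T (j + 1) φ.neg) ?_ ?_ ?_
      · exact fun φ ψ e hfv h => h.congr e.neg (by simp [hfv])
      · exact fun φ h => RSig.toPi hT ((ih φ).1 (by omega) h)
      · exact fun φ h h' => (RPi.all hT h').congr (Eqv.not_ex hT.substClosed φ) (by simp [Fml.fv])

theorem RPi.neg {j : ℕ} (hj : j ≤ m) {φ : Fml} (h : RPi T j φ) : RSig T j φ.neg :=
  (prenex_neg hT hD j φ).1 hj h

theorem RSig.neg {j : ℕ} (hj : j ≤ m + 1) {φ : Fml} (h : RSig T j φ) : RPi T j φ.neg :=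
  (prenex_neg hT hD j φ).2 hj h

/-- Under `¬¬`, a universal quantifier can be pulled out of a disjunction: if neither `∀φ` nor χ
holds, each instance of φ is not false, hence true by stability of `Π_j`. Once the leading universal
block is removed, the disjunction of `Σ` formulas is itself `Σ` and stable, so the double negation
disappears. -/
theorem RPi.dn_or {j : ℕ} (hj : j ≤ m + 1) {φ χ : Fml} (h : RPi T j φ) (h' : RPi T j χ) :
    RPi T j (φ.or χ).neg.neg := by
  have hs := hT.substClosed
  have base : ∀ i ≤ m, ∀ φ χ, RSig T i φ → RSig T i χ → RSig T i (φ.or χ).neg.neg := by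
    intro i hi φ χ h h'
    have := RSig.or hT h h'
    exact this.congr (RSig.stable hT hD hi this).eqv (by simp)
  cases j with
  | zero =>
    rw [← RSig.zero_iff_RPi] at h h' ⊢
    exact base 0 (Nat.zero_le _) _ _ h h'
  | succ j =>
    refine RPi.binop hT (op := fun φ χ => (φ.or χ).neg.neg)
      (fun _ _ _ _ e e' => (e.or e').neg.neg) (fun _ _ => by simp [Fml.fv]) ?_ ?_
      (fun φ χ h h' => RSig.toPi hT (base j (by omega) φ χ h h')) h h'
    · intro φ χ h Γ
      rw [Derives.all_iff hs]
      simp only [Fml.inst_neg, Fml.inst_or, Fml.shift_inst]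
      refine ⟨fun d t => d.dn_map (.orE .hyp0 (.orIl (.allE t .hyp0)) (.orIr .hyp0)), fun d => ?_⟩
      refine .negI (.negE .hyp0 (.orIl (.allI_inst hs fun t => ?_)))
      refine RPi.stable hT hD hj (RPi.inst hT h t) _ (.negI (.dnE (d t).wk.wk ?_))
      exact .orE .hyp0 (.negE .hyp2 .hyp0)
        (.negE (.hyp (φ := (φ.all.or χ).neg) (by simp)) (.orIr .hyp0))
    · intro φ χ h Γ
      rw [Derives.all_iff hs]
      simp only [Fml.inst_neg, Fml.inst_or, Fml.shift_inst]
      refine ⟨fun d t => d.dn_map (.orE .hyp0 (.orIl .hyp0) (.orIr (.allE t .hyp0))), fun d => ?_⟩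
      refine .negI (.negE .hyp0 (.orIr (.allI_inst hs fun t => ?_)))
      refine RPi.stable hT hD hj (RPi.inst hT h t) _ (.negI (.dnE (d t).wk.wk ?_))
      exact .orE .hyp0 (.negE (.hyp (φ := (φ.or χ.all).neg) (by simp)) (.orIl .hyp0))
        (.negE .hyp2 .hyp0)

end

/-! ### Prenex forms of the formulas without disjunction -/

/-- All paths have length at most `j`, and those of length `j` do not start with the sign `!b`. -/
def PathsLe (b : Bool) (j : ℕ) (A : Finset (List Bool)) : Prop :=
  ∀ s ∈ A, s.length < j ∨ s.length = j ∧ s.head? ≠ some (!b)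

abbrev AltLe (b : Bool) (j : ℕ) (φ : Fml) : Prop := PathsLe b j (alt φ)

theorem alt_nonempty (φ : Fml) : (alt φ).Nonempty := by
  induction φ with
  | bot | eq => simp [alt]
  | and φ ψ h₁ h₂ | or φ ψ h₁ h₂ => simp [alt, h₁]
  | imp φ ψ h₁ h₂ => cases ψ <;> simp [alt, h₁]
  | all φ ih | ex φ ih => simpa [alt] using ih

theorem pathsLe_nil (b : Bool) (j : ℕ) : PathsLe b j {[]} := by
  intro s hs
  rw [Finset.mem_singleton] at hs
  subst hs
  rcases j.eq_zero_or_pos with h | h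
  · exact .inr ⟨h.symm, by simp⟩
  · exact .inl h

theorem pathsLe_union {b : Bool} {j : ℕ} {A B : Finset (List Bool)} :
    PathsLe b j (A ∪ B) ↔ PathsLe b j A ∧ PathsLe b j B := by
  simp only [PathsLe, Finset.mem_union]
  grind

theorem head?_perp (s : List Bool) : (perp s).head? = s.head?.map not := by
  cases s <;> rfl

@[simp] theorem length_perp (s : List Bool) : (perp s).length = s.length := by simp [perp]

theorem perp_perp (s : List Bool) : perp (perp s) = s := by
  simp [perp, Function.comp_def]

theorem pathsLe_perp {b : Bool} {j : ℕ} {A : Finset (List Bool)}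
    (h : PathsLe b j (A.image perp)) : PathsLe (!b) j A := by
  intro s hs
  have := h _ (Finset.mem_image_of_mem _ hs)
  rw [length_perp, head?_perp] at this
  refine this.imp_right fun ⟨h₁, h₂⟩ => ⟨h₁, fun h₃ => h₂ ?_⟩
  simp [h₃]

theorem head?_pushSign (b : Bool) (s : List Bool) : (pushSign b s).head? = some b := by
  unfold pushSign
  split_ifs with h
  · exact h
  · rfl

theorem pathsLe_push_same {b : Bool} {j : ℕ} {A : Finset (List Bool)}
    (h : PathsLe b j (A.image (pushSign b))) : PathsLe b j A := by
  intro s hs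
  have := h _ (Finset.mem_image_of_mem _ hs)
  unfold pushSign at this
  split_ifs at this with hb
  · exact this
  · simp only [List.length_cons] at this
    left
    omega

theorem pathsLe_push_ne_zero {b c : Bool} {A : Finset (List Bool)} (hA : A.Nonempty) :
    ¬ PathsLe b 0 (A.image (pushSign c)) := by
  intro h
  obtain ⟨s, hs⟩ := hA
  have h₁ := h _ (Finset.mem_image_of_mem _ hs)
  have h₂ := head?_pushSign c s
  cases hp : pushSign c s with
  | nil => simp [hp] at h₂
  | cons a l => simp [hp] at h₁

/-- All paths start with the sign `b`, and those of length j + 1 may not, so all have length at most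
j. Thus a formula whose outer quantifier has the wrong kind for its level already belongs one level
lower, on the side of that quantifier. -/
theorem pathsLe_push_diff {b : Bool} {j : ℕ} {A : Finset (List Bool)}
    (h : PathsLe (!b) (j + 1) (A.image (pushSign b))) : PathsLe b j (A.image (pushSign b)) := by
  intro s hs
  have h₁ := h s hs
  obtain ⟨t, -, rfl⟩ := Finset.mem_image.1 hs
  rw [head?_pushSign] at h₁ ⊢
  simp only [Bool.not_not, ne_eq, not_true, and_false, or_false] at h₁
  rcases (Nat.lt_succ_iff.1 h₁).lt_or_eq with h₂ | h₂
  · exact .inl h₂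
  · exact .inr ⟨h₂, by simp⟩

theorem AltLe.imp {b : Bool} {j : ℕ} {φ ψ : Fml} (h : AltLe b j (φ.imp ψ)) :
    AltLe (!b) j φ ∧ AltLe b j ψ := by
  by_cases hψ : ψ = .bot
  · subst hψ
    exact ⟨pathsLe_perp (by simpa [AltLe, alt] using h), pathsLe_nil _ _⟩
  · have e : alt (φ.imp ψ) = (alt φ).image perp ∪ alt ψ := by
      cases ψ <;> first | exact absurd rfl hψ | simp [alt]
    rw [AltLe, e, pathsLe_union] at h
    exact ⟨pathsLe_perp h.1, h.2⟩

theorem AltLe.and {b : Bool} {j : ℕ} {φ ψ : Fml} (h : AltLe b j (φ.and ψ)) :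
    AltLe b j φ ∧ AltLe b j ψ := by
  rwa [AltLe, alt, pathsLe_union] at h

theorem AltLe.of_mem_EClass {j : ℕ} {φ : Fml} (h : φ ∈ EClass j) : AltLe true j φ := by
  intro s hs
  cases j with
  | zero =>
    have := Finset.le_sup (f := List.length) hs
    have h : degree φ = 0 := h
    rw [← degree, h, Nat.le_zero, List.length_eq_zero_iff] at this
    subst this
    exact .inr ⟨rfl, by simp⟩
  | succ j =>
    have h₁ : degree φ = j + 1 := h.1
    have := Finset.le_sup (f := List.length) hs
    rw [← degree, h₁] at this
    rcases this.lt_or_eq with h₂ | h₂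
    · exact .inl h₂
    · exact .inr ⟨h₂, by simp [h.2 s hs h₂]⟩

theorem imp_eqv_dn_or {T : Set Fml} {φ χ : Fml} (h : Stable T χ) :
    Eqv T (φ.imp χ) (φ.neg.or χ).neg.neg := fun Γ => by
  refine ⟨fun d => .negI (.negE .hyp0 (.orIl (.negI ?_))), fun d => .impI (h _ (.negI ?_))⟩
  · exact .negE .hyp1 (.orIr (.impE d.wk.wk .hyp0))
  · exact d.wk.wk.dnE (.orE .hyp0 (.negE .hyp0 (.hyp (by simp))) (.negE .hyp2 .hyp0))

section

variable {T : Set Fml} (hT : ArithTheory T) {m : ℕ} (hD : ∀ φ, RSig T m φ → Stable T φ)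
include hT hD

/-- Both sides are proved together because implication exchanges them in its premise.
Disjunction-freeness matters on the `Π` side, where closure is available only for `¬¬(φ ∨ χ)`; that
is the only form in which implication produces a disjunction there. -/
theorem rep_of_altLe {φ : Fml} (hφ : φ.OrFree) {j : ℕ} (hj : j ≤ m) :
    (AltLe false j φ → RPi T j φ) ∧ (AltLe true j φ → RSig T j φ) := by
  induction φ generalizing j with
  | bot | eq =>
    exact ⟨fun _ => RPi.mono hT (Nat.zero_le _) (.of_isQF trivial),
      fun _ => RSig.mono hT (Nat.zero_le _) (.of_isQF trivial)⟩
  | and φ ψ h₁ h₂ =>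
    exact ⟨fun h => RPi.and hT ((h₁ hφ.1 hj).1 h.and.1) ((h₂ hφ.2 hj).1 h.and.2),
      fun h => RSig.and hT ((h₁ hφ.1 hj).2 h.and.1) ((h₂ hφ.2 hj).2 h.and.2)⟩
  | or => exact hφ.elim
  | imp φ ψ h₁ h₂ =>
    constructor
    · intro h
      have h₁ := (h₁ hφ.1 hj).2 h.imp.1
      have h₂ := (h₂ hφ.2 hj).1 h.imp.2
      exact (RPi.dn_or hT hD (by omega) (RSig.neg hT hD (by omega) h₁) h₂).congr
        (imp_eqv_dn_or (RPi.stable hT hD (by omega) h₂)) (by simp [Fml.fv])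
    · intro h
      have h₁ := (h₁ hφ.1 hj).1 h.imp.1
      have h₂ := (h₂ hφ.2 hj).2 h.imp.2
      have := RSig.or hT (RPi.neg hT hD hj h₁) h₂
      exact this.congr ((imp_eqv_dn_or (RSig.stable hT hD hj h₂)).trans
        (RSig.stable hT hD hj this).eqv) (by simp [Fml.fv])
  | all φ ih =>
    have key : ∀ {j}, j ≤ m → AltLe false j φ.all → RPi T j φ.all := by
      intro j hj h
      rw [AltLe, alt] at h
      cases j with
      | zero => exact (pathsLe_push_ne_zero (alt_nonempty φ) h).elim
      | succ j => exact RPi.all hT ((ih hφ hj).1 (pathsLe_push_same h))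
    refine ⟨key hj, fun h => ?_⟩
    rw [AltLe, alt] at h
    cases j with
    | zero => exact (pathsLe_push_ne_zero (alt_nonempty φ) h).elim
    | succ j => exact RPi.toSig hT (key (by omega) (pathsLe_push_diff (b := false) h))
  | ex φ ih =>
    have key : ∀ {j}, j ≤ m → AltLe true j φ.ex → RSig T j φ.ex := by
      intro j hj h
      rw [AltLe, alt] at h
      cases j with
      | zero => exact (pathsLe_push_ne_zero (alt_nonempty φ) h).elim
      | succ j => exact RSig.ex hT ((ih hφ hj).2 (pathsLe_push_same h))
    refine ⟨fun h => ?_, key hj⟩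
    rw [AltLe, alt] at h
    cases j with
    | zero => exact (pathsLe_push_ne_zero (alt_nonempty φ) h).elim
    | succ j => exact RSig.toPi hT (key (by omega) (pathsLe_push_diff (b := true) h))

omit hT hD in
theorem not_and_eqv_dn_or (T : Set Fml) (φ χ : Fml) :
    Eqv T (φ.and χ).neg (φ.neg.or χ.neg).neg.neg := fun Γ => by
  refine ⟨fun d => .negI (.negE .hyp0 (.orIl (.negI (.negE .hyp1 (.orIr (.negI ?_)))))),
    fun d => .negI (d.wk.dnE ?_)⟩
  · exact .negE d.wk.wk.wk (.andI .hyp1 .hyp0)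
  · exact .orE .hyp0 (.negE .hyp0 (Derives.andEl .hyp2)) (.negE .hyp0 (Derives.andEr .hyp2))

/-- `Σ_{m+1}` formulas need not be stable, so the existential side is represented through its
negation. A premise of an implication enters `¬¬(¬φ ∨ χ)` only negated, and `¬(φ → χ)` is `φ ∧ ¬χ`
for stable φ, so the weaker information is enough for the recursion. Outer quantifiers of the wrong
kind fall to level m. -/
theorem rep_of_altLe_succ {φ : Fml} (hφ : φ.OrFree) :
    (AltLe false (m + 1) φ → RPi T (m + 1) φ) ∧
      (AltLe true (m + 1) φ → RPi T (m + 1) φ.neg) := by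
  induction φ with
  | bot | eq =>
    exact ⟨fun _ => RPi.mono hT (Nat.zero_le _) (.of_isQF trivial),
      fun _ => RPi.mono hT (Nat.zero_le _) (.of_isQF ⟨trivial, trivial⟩)⟩
  | and φ ψ h₁ h₂ =>
    refine ⟨fun h => RPi.and hT ((h₁ hφ.1).1 h.and.1) ((h₂ hφ.2).1 h.and.2), fun h => ?_⟩
    exact (RPi.dn_or hT hD le_rfl ((h₁ hφ.1).2 h.and.1) ((h₂ hφ.2).2 h.and.2)).congr
      (not_and_eqv_dn_or T φ ψ) (by simp [Fml.fv])
  | or => exact hφ.elim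
  | imp φ ψ h₁ h₂ =>
    constructor
    · intro h
      have h₁ := (h₁ hφ.1).2 h.imp.1
      have h₂ := (h₂ hφ.2).1 h.imp.2
      exact (RPi.dn_or hT hD le_rfl h₁ h₂).congr
        (imp_eqv_dn_or (RPi.stable hT hD le_rfl h₂)) (by simp [Fml.fv])
    · intro h
      have h₁ := (h₁ hφ.1).1 h.imp.1
      have h₂ := (h₂ hφ.2).2 h.imp.2
      refine (RPi.and hT h₁ h₂).congr (fun Γ => ⟨fun d => ?_, fun d => .negI ?_⟩)
        (by simp [Fml.fv])
      · refine .andI (RPi.stable hT hD le_rfl h₁ _ (.negI (.negE d.wk (.impI ?_)))) (.negI ?_)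
        · exact .negE .hyp1 .hyp0
        · exact .negE d.wk (.impI .hyp1)
      · exact .negE d.wk.andEr (.impE .hyp0 d.wk.andEl)
  | all φ ih =>
    constructor <;> intro h
    · rw [AltLe, alt] at h
      exact RPi.all hT ((ih hφ).1 (pathsLe_push_same h))
    · have h' : AltLe false m φ.all := by
        rw [AltLe, alt] at h ⊢
        exact pathsLe_push_diff h
      exact RSig.toPi hT (RPi.neg hT hD le_rfl ((rep_of_altLe hT hD hφ le_rfl).1 h'))
  | ex φ ih =>
    constructor <;> intro h
    · have h' : AltLe true m φ.ex := by
        rw [AltLe, alt] at h ⊢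
        exact pathsLe_push_diff h
      exact RSig.toPi hT ((rep_of_altLe hT hD hφ le_rfl).2 h')
    · rw [AltLe, alt] at h
      exact (RPi.all hT ((ih hφ).2 (pathsLe_push_same h))).congr (Eqv.not_ex hT.substClosed φ)
        (by simp [Fml.fv])

theorem rep_neg_of_mem_EClass {φ : Fml} (hφ : φ.OrFree) {j : ℕ} (hj : j ≤ m + 1)
    (h : φ ∈ EClass j) : RPi T j φ.neg := by
  rcases hj.lt_or_eq with h' | rfl
  · exact RSig.neg hT hD hj ((rep_of_altLe hT hD hφ (by omega)).2 (.of_mem_EClass h))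
  · exact (rep_of_altLe_succ hT hD hφ).2 (.of_mem_EClass h)

end

/-! ### Conservation of classical arithmetic -/

theorem PA_substClosed : SubstClosed PA := by
  rintro φ (h | ⟨ψ, rfl⟩) σ
  · exact .inl (HA_substClosed _ h σ)
  · exact .inr ⟨ψ.subst σ, rfl⟩

section

variable {T : Set Fml} (hT : ArithTheory T)
include hT

/-- Only implication is delicate: to pass from the translated implication to `((φ → ψ) → R) → R` one
decides the premise φ. -/
theorem tr_eqv_of_isQF {φ : Fml} (h : φ.IsQF) (R : Fml) :
    Eqv T (φ.tr R) ((φ.imp R).imp R) := by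
  induction φ with
  | bot => exact fun Γ => ⟨fun d => .impI d.wk, fun d => .impE d (.impI (.botE .hyp0))⟩
  | eq => exact .refl _
  | and φ ψ h₁ h₂ =>
    refine ((h₁ h.1).and (h₂ h.2)).trans fun Γ => ⟨fun d => .impI ?_, fun d => .andI ?_ ?_⟩
    · refine .impE d.wk.andEl (.impI (.impE d.wk.wk.andEr (.impI ?_)))
      exact .impE .hyp2 (.andI .hyp1 .hyp0)
    · exact .impI (.impE d.wk (.impI (.impE .hyp1 (Derives.andEl .hyp0))))
    · exact .impI (.impE d.wk (.impI (.impE .hyp1 (Derives.andEr .hyp0))))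
  | or φ ψ h₁ h₂ =>
    refine (((((h₁ h.1).imp (.refl R)).and ((h₂ h.2).imp (.refl R)))).imp (.refl R)).trans
      fun Γ => ⟨fun d => .impI (.impE d.wk (.andI ?_ ?_)), fun d => .impI (.impE d.wk (.impI ?_))⟩
    · exact .impI (.impE .hyp0 (.impI (.impE .hyp2 (.orIl .hyp0))))
    · exact .impI (.impE .hyp0 (.impI (.impE .hyp2 (.orIr .hyp0))))
    · refine .orE .hyp0 ?_ ?_
      · exact .impE (Derives.andEl .hyp2) (.relI .hyp0)
      · exact .impE (Derives.andEr .hyp2) (.relI .hyp0)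
  | imp φ ψ h₁ h₂ =>
    refine ((h₁ h.1).imp (h₂ h.2)).trans fun Γ => ⟨fun d => .impI ?_, fun d => .impI (.impI ?_)⟩
    · refine .orE (hT.qf_em h.1) (.impE (.impE d.wk.wk (.relI .hyp0)) (.impI ?_)) ?_
      · exact .impE .hyp2 (.impI .hyp1)
      · exact .impE .hyp1 (.impI (.negE .hyp1 .hyp0))
    · refine .impE .hyp1 (.impI (.impE d.wk.wk.wk (.impI ?_)))
      exact .impE .hyp2 (.impE .hyp0 .hyp1)
  | all | ex => exact h.elim

variable {m : ℕ} (hD : ∀ φ, RSig T m φ → Stable T φ) (hL : ∀ φ, RPi T m φ → Dec T φ)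
include hD hL

theorem tr_eqv_of_prenex (j : ℕ) (φ : Fml) :
    (φ ∈ SigmaClass j → j ≤ m + 1 → ∀ R, Eqv T (φ.tr R) ((φ.imp R).imp R)) ∧
      (φ ∈ PiClass j → j ≤ m → ∀ R, Eqv T (φ.tr R) ((φ.imp R).imp R)) := by
  have hs := hT.substClosed
  refine prenex_induction (P := fun j φ => j ≤ m + 1 → ∀ R, Eqv T (φ.tr R) ((φ.imp R).imp R))
    (Q := fun j φ => j ≤ m → ∀ R, Eqv T (φ.tr R) ((φ.imp R).imp R)) ?_ ?_ ?_ ?_ j φ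
  · exact fun φ h _ R => tr_eqv_of_isQF hT h R
  · exact fun φ h _ R => tr_eqv_of_isQF hT h R
  · intro j φ h hj R
    have ih : Eqv T (φ.tr R.shift) ((φ.imp R.shift).imp R.shift) :=
      h.elim (fun h => h.2 hj _) fun h => h.2 (by omega) _
    refine Eqv.trans (((ih.imp (.refl _)).all hs).imp (.refl R)) fun Γ =>
      ⟨fun d => .impI (.impE d.wk (.allI_inst hs fun t => ?_)), fun d => .impI (.impE d.wk ?_)⟩
    · simp only [Fml.inst_imp, Fml.shift_inst]
      exact .impI (.impE .hyp0 (.impI (.impE .hyp2 (.exI t .hyp0))))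
    · refine .impI (.exE_inst hs .hyp0 fun t => ?_)
      have := Derives.allE t (.hyp2 (T := T) (ξ := φ.inst t) (ψ := φ.ex) (Γ := Γ)
        (φ := (((φ.imp R.shift).imp R.shift).imp R.shift).all))
      simp only [Fml.inst_imp, Fml.shift_inst] at this
      exact .impE this (.relI .hyp0)
  · intro j φ h hj R
    have ih : Eqv T (φ.tr R.shift) ((φ.imp R.shift).imp R.shift) :=
      h.elim (fun h => h.2 hj _) fun h => h.2 (by omega) _
    have hφ : RPi T (j + 1) φ :=
      h.elim (fun h => .of_mem h.1) fun h => RSig.toPi hT (.of_mem h.1)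
    refine Eqv.trans (ih.all hs) fun Γ => ⟨fun d => ?_, fun d => .allI_inst hs fun t => ?_⟩
    · refine .orE (hL _ (RPi.mono hT hj (RPi.all hT hφ)) Γ) (.relI .hyp0) ?_
      have e := RPi.not_all_eqv hT hD (by omega) hφ
        (RSig.stable hT hD hj (RSig.ex hT (RPi.neg hT hD hj hφ)))
      refine .exE_inst hs ((e _).1 .hyp0) fun t => .impI ?_
      have := d.allE t
      simp only [Fml.inst_imp, Fml.shift_inst] at this
      exact .impE this.wk.wk.wk (.impI (.negE .hyp2 .hyp0))
    · simp only [Fml.inst_imp, Fml.shift_inst]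
      exact .impI (.impE d.wk (.impI (.impE .hyp1 (.allE t .hyp0))))

/-- Friedman's trick: with φ itself in place of `R`, the translated theorem is `(φ → φ) → φ`. -/
theorem proves_sigma_of_PA {φ : Fml} (hφ : φ ∈ SigmaClass (m + 1)) (h : Proves PA φ) :
    Proves T φ := by
  have h₁ : Derives T [] (φ.tr φ) := (derives_tr h φ).mono hT.ha
  exact .impE (((tr_eqv_of_prenex hT hD hL _ φ).1 hφ le_rfl φ _).1 h₁) (.impI .hyp0)

/-- `PA` is `Π_{m+2}`-conservative over a theory with `Π_m-LEM` and `Σ_m-DNE`. -/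
theorem proves_pi_of_PA {φ : Fml} (hφ : φ ∈ PiClass (m + 2)) (h : Proves PA φ) :
    Proves T φ := by
  induction φ with
  | all φ ih =>
    have h' : Proves PA φ := by
      have := Derives.allE (.var 0) (Derives.subst PA_substClosed h sshift)
      rwa [Fml.subst_liftSubst_sshift_inst] at this
    obtain ⟨ψ, e, hψ⟩ := mem_piClass_succ.1 hφ
    cases e
    exact .allI (hψ.elim (fun hψ => ih hψ h') fun hψ => proves_sigma_of_PA hT hD hL hψ h')
  | _ => obtain ⟨ψ, e, -⟩ := mem_piClass_succ.1 hφ; cases e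

end

/-! ### Doubly negated axioms -/

theorem map_shift_eq_self {Δ : List Fml} (h : ∀ A ∈ Δ, A.fv = ∅) : Δ.map Fml.shift = Δ := by
  conv_rhs => rw [← List.map_id Δ]
  exact List.map_congr_left fun A hA => Fml.subst_eq_self (h A hA) _

/-- Finitely many of the axioms in `Ax` are used in a derivation. -/
theorem Derives.compact {T Ax : Set Fml} {Γ : List Fml} {φ : Fml}
    (h : Derives (T ∪ Ax) Γ φ) : ∃ Δ : List Fml, (∀ A ∈ Δ, A ∈ Ax) ∧
      ∀ Δ', Δ ⊆ Δ' → (∀ A ∈ Δ', A.fv = ∅) → Derives T (Γ ++ Δ') φ := by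
  have app : ∀ {Δ₁ Δ₂ : List Fml}, (∀ A ∈ Δ₁, A ∈ Ax) → (∀ A ∈ Δ₂, A ∈ Ax) →
      ∀ A ∈ Δ₁ ++ Δ₂, A ∈ Ax := fun h₁ h₂ A hA => (List.mem_append.1 hA).elim (h₁ A) (h₂ A)
  have sl : ∀ {Δ₁ Δ₂ Δ' : List Fml}, Δ₁ ++ Δ₂ ⊆ Δ' → Δ₁ ⊆ Δ' := fun h _ hA =>
    h (List.mem_append_left _ hA)
  have sr : ∀ {Δ₁ Δ₂ Δ' : List Fml}, Δ₁ ++ Δ₂ ⊆ Δ' → Δ₂ ⊆ Δ' := fun h _ hA =>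
    h (List.mem_append_right _ hA)
  induction h with
  | ax h =>
    rcases h with h | h
    · exact ⟨[], by simp, fun _ _ _ => .ax h⟩
    · exact ⟨[_], by simpa using h, fun Δ' hs _ => .hyp (by simp [List.cons_subset.1 hs])⟩
  | hyp h => exact ⟨[], by simp, fun _ _ _ => .hyp (by simp [h])⟩
  | botE _ ih =>
    obtain ⟨Δ, h₁, h⟩ := ih
    exact ⟨Δ, h₁, fun Δ' hs hc => .botE (h Δ' hs hc)⟩
  | andI _ _ ih ih' =>
    obtain ⟨Δ₁, h₁, h⟩ := ih
    obtain ⟨Δ₂, h₂, h'⟩ := ih'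
    exact ⟨_, app h₁ h₂, fun Δ' hs hc => .andI (h Δ' (sl hs) hc) (h' Δ' (sr hs) hc)⟩
  | andEl _ ih =>
    obtain ⟨Δ, h₁, h⟩ := ih
    exact ⟨Δ, h₁, fun Δ' hs hc => .andEl (h Δ' hs hc)⟩
  | andEr _ ih =>
    obtain ⟨Δ, h₁, h⟩ := ih
    exact ⟨Δ, h₁, fun Δ' hs hc => .andEr (h Δ' hs hc)⟩
  | orIl _ ih =>
    obtain ⟨Δ, h₁, h⟩ := ih
    exact ⟨Δ, h₁, fun Δ' hs hc => .orIl (h Δ' hs hc)⟩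
  | orIr _ ih =>
    obtain ⟨Δ, h₁, h⟩ := ih
    exact ⟨Δ, h₁, fun Δ' hs hc => .orIr (h Δ' hs hc)⟩
  | orE _ _ _ ih ih' ih'' =>
    obtain ⟨Δ₁, h₁, h⟩ := ih
    obtain ⟨Δ₂, h₂, h'⟩ := ih'
    obtain ⟨Δ₃, h₃, h''⟩ := ih''
    exact ⟨_, app h₁ (app h₂ h₃), fun Δ' hs hc =>
      .orE (h Δ' (sl hs) hc) (h' Δ' (sl (sr hs)) hc) (h'' Δ' (sr (sr hs)) hc)⟩
  | impI _ ih =>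
    obtain ⟨Δ, h₁, h⟩ := ih
    exact ⟨Δ, h₁, fun Δ' hs hc => .impI (h Δ' hs hc)⟩
  | impE _ _ ih ih' =>
    obtain ⟨Δ₁, h₁, h⟩ := ih
    obtain ⟨Δ₂, h₂, h'⟩ := ih'
    exact ⟨_, app h₁ h₂, fun Δ' hs hc => .impE (h Δ' (sl hs) hc) (h' Δ' (sr hs) hc)⟩
  | allI _ ih =>
    obtain ⟨Δ, h₁, h⟩ := ih
    -- The extracted axioms are closed, so they are unchanged by the shift and may stay in the
    -- context under the quantifier.
    refine ⟨Δ, h₁, fun Δ' hs hc => .allI ?_⟩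
    rw [List.map_append, map_shift_eq_self hc]
    exact h Δ' hs hc
  | allE t _ ih =>
    obtain ⟨Δ, h₁, h⟩ := ih
    exact ⟨Δ, h₁, fun Δ' hs hc => .allE t (h Δ' hs hc)⟩
  | exI t _ ih =>
    obtain ⟨Δ, h₁, h⟩ := ih
    exact ⟨Δ, h₁, fun Δ' hs hc => .exI t (h Δ' hs hc)⟩
  | exE _ _ ih ih' =>
    obtain ⟨Δ₁, h₁, h⟩ := ih
    obtain ⟨Δ₂, h₂, h'⟩ := ih'
    refine ⟨_, app h₁ h₂, fun Δ' hs hc => .exE (h Δ' (sl hs) hc) ?_⟩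
    rw [List.map_append, map_shift_eq_self hc]
    exact h' Δ' (sr hs) hc

/-- If `T` proves the double negations of the axioms `Ax`, then it proves the double negations of
their consequences. -/
theorem proves_dn_of_proves {T S Ax : Set Fml} (hST : IsExtension T S)
    (hAx : ∀ A ∈ Ax, A.fv = ∅) (hdn : ∀ A ∈ Ax, Proves T A.neg.neg) {χ : Fml}
    (h : Proves (S ∪ Ax) χ) : Proves T χ.neg.neg := by
  obtain ⟨Δ, h₁, h₂⟩ := h.compact
  have h₃ := h₂ Δ (List.Subset.refl _) fun A hA => hAx A (h₁ A hA)
  rw [List.nil_append] at h₃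
  clear h h₂
  induction Δ generalizing χ with
  | nil => exact .dnI (hST _ h₃)
  | cons A Δ ih =>
    -- The axiom `A` is moved to the right: `¬¬A` and `¬¬(A → χ)` give `¬¬χ`.
    have h₄ := ih (fun B hB => h₁ B (by simp [hB])) (.impI h₃)
    refine .negI ((Derives.wk (hdn A (h₁ A (by simp)))).dnE (h₄.wk.wk.dnE ?_))
    exact .negE .hyp2 (.impE .hyp0 .hyp1)

theorem fv_eq_empty_of_mem_LEM {C : Set Fml} {A : Fml} (h : A ∈ LEM C) : A.fv = ∅ := by
  obtain ⟨φ, -, hfv, rfl⟩ := h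
  ext n
  have : n + 1 ∉ φ.fv := fun hn => by simpa using hfv hn
  simp [Fml.fv, this]

theorem fv_eq_empty_of_mem_DNE {C : Set Fml} {A : Fml} (h : A ∈ DNE C) : A.fv = ∅ := by
  obtain ⟨φ, -, hfv, rfl⟩ := h
  ext n
  have : n + 1 ∉ φ.fv := fun hn => by simpa using hfv hn
  simp [Fml.fv, this]

theorem arithTheory_union {Ax : Set Fml} (hAx : ∀ A ∈ Ax, A.fv = ∅) : ArithTheory (HA ∪ Ax) where
  substClosed := by
    rintro φ (h | h) σ
    · exact .inl (HA_substClosed _ h σ)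
    · rw [Fml.subst_eq_self (hAx _ h)]
      exact .inr h
  ha := Set.subset_union_left

/-! ### Eliminating disjunctions from prenex formulas -/

namespace Fml

/-- Replace `φ ∨ ψ` by `¬ φ → ψ`. -/
def orElim : Fml → Fml
  | bot => bot
  | eq t u => eq t u
  | and φ ψ => φ.orElim.and ψ.orElim
  | or φ ψ => φ.orElim.neg.imp ψ.orElim
  | imp φ ψ => φ.orElim.imp ψ.orElim
  | all φ => φ.orElim.all
  | ex φ => φ.orElim.ex

theorem orElim_orFree (φ : Fml) : φ.orElim.OrFree := by
  induction φ with
  | bot | eq => trivial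
  | and φ ψ h₁ h₂ | imp φ ψ h₁ h₂ => exact ⟨h₁, h₂⟩
  | or φ ψ h₁ h₂ => exact ⟨⟨h₁, trivial⟩, h₂⟩
  | all φ ih | ex φ ih => exact ih

theorem IsQF.orElim {φ : Fml} (h : φ.IsQF) : φ.orElim.IsQF := by
  induction φ with
  | bot | eq => trivial
  | and φ ψ h₁ h₂ | imp φ ψ h₁ h₂ => exact ⟨h₁ h.1, h₂ h.2⟩
  | or φ ψ h₁ h₂ => exact ⟨⟨h₁ h.1, trivial⟩, h₂ h.2⟩
  | all | ex => exact h.elim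

end Fml

theorem orElim_eqv_of_isQF {T : Set Fml} (hT : ArithTheory T) {φ : Fml} (h : φ.IsQF) :
    Eqv T φ φ.orElim := by
  induction φ with
  | bot | eq => exact .refl _
  | and φ ψ h₁ h₂ => exact (h₁ h.1).and (h₂ h.2)
  | imp φ ψ h₁ h₂ => exact (h₁ h.1).imp (h₂ h.2)
  | or φ ψ h₁ h₂ =>
    refine ((h₁ h.1).or (h₂ h.2)).trans fun Γ => ⟨fun d => .impI ?_, fun d => ?_⟩
    · exact .orE d.wk (.negE .hyp1 .hyp0) .hyp0
    · exact .orE (hT.qf_em h.1.orElim) (.orIl .hyp0) (.orIr (.impE d.wk .hyp0))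
  | all | ex => exact h.elim

/-- In a prenex formula disjunctions occur only in the decidable matrix. Hence the restriction to
disjunction-free formulas in conditions 1 and 2 costs nothing when `Σ-DNE` is derived. -/
theorem prenex_orElim {T : Set Fml} (hT : ArithTheory T) (j : ℕ) (φ : Fml) :
    (φ ∈ SigmaClass j → φ.orElim ∈ SigmaClass j ∧ Eqv T φ φ.orElim) ∧
      (φ ∈ PiClass j → φ.orElim ∈ PiClass j ∧ Eqv T φ φ.orElim) := by
  refine prenex_induction (P := fun j φ => φ.orElim ∈ SigmaClass j ∧ Eqv T φ φ.orElim)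
    (Q := fun j φ => φ.orElim ∈ PiClass j ∧ Eqv T φ φ.orElim) ?_ ?_ ?_ ?_ j φ
  · exact fun φ h => ⟨mem_sigmaClass_zero.2 h.orElim, orElim_eqv_of_isQF hT h⟩
  · exact fun φ h => ⟨mem_piClass_zero.2 h.orElim, orElim_eqv_of_isQF hT h⟩
  · exact fun j φ h => ⟨mem_sigmaClass_succ.2 ⟨_, rfl, h.imp (fun h => h.2.1) fun h => h.2.1⟩,
      (h.elim (fun h => h.2.2) fun h => h.2.2).ex hT.substClosed⟩
  · exact fun j φ h => ⟨mem_piClass_succ.2 ⟨_, rfl, h.imp (fun h => h.2.1) fun h => h.2.1⟩,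
      (h.elim (fun h => h.2.2) fun h => h.2.2).all hT.substClosed⟩

/-! ### Alternation paths of the relevant formulas -/

theorem alt_prenex (j : ℕ) (φ : Fml) :
    (φ ∈ SigmaClass j → ∀ s ∈ alt φ, s.length = j ∧ s.head? ≠ some false) ∧
      (φ ∈ PiClass j → ∀ s ∈ alt φ, s.length = j ∧ s.head? ≠ some true) := by
  have hpush : ∀ (b : Bool) (j : ℕ) (s : List Bool), (s.length = j + 1 ∧ s.head? ≠ some (!b)) ∨
      (s.length = j ∧ s.head? ≠ some b) →
      (pushSign b s).length = j + 1 ∧ (pushSign b s).head? ≠ some (!b) := by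
    rintro b j s h
    refine ⟨?_, by rw [head?_pushSign]; simp⟩
    cases s with
    | nil => simpa [pushSign, eq_comm] using h
    | cons a l => cases a <;> cases b <;> simpa [pushSign] using h
  refine prenex_induction (P := fun j φ => ∀ s ∈ alt φ, s.length = j ∧ s.head? ≠ some false)
    (Q := fun j φ => ∀ s ∈ alt φ, s.length = j ∧ s.head? ≠ some true) ?_ ?_ ?_ ?_ j φ
  · intro φ h s hs
    rw [alt_of_isQF φ h, Finset.mem_singleton] at hs
    simp [hs]
  · intro φ h s hs
    rw [alt_of_isQF φ h, Finset.mem_singleton] at hs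
    simp [hs]
  · intro j φ h s hs
    rw [alt] at hs
    obtain ⟨t, ht, rfl⟩ := Finset.mem_image.1 hs
    exact hpush true j t (h.imp (fun h => h.2 t ht) fun h => h.2 t ht)
  · intro j φ h s hs
    rw [alt] at hs
    obtain ⟨t, ht, rfl⟩ := Finset.mem_image.1 hs
    exact hpush false j t (h.imp (fun h => h.2 t ht) fun h => h.2 t ht)

/-- The paths of φ have length j + 1 and start with +. The premise `¬¬φ` contributes their duals,
which start with - and are not lengthened by the outer `∀`; the conclusion contributes the paths
themselves, which grow to length j + 2. -/
theorem dne_mem_UClass {j : ℕ} {φ : Fml} (h : φ ∈ SigmaClass (j + 1)) :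
    (φ.neg.neg.imp φ).all ∈ UClass (j + 2) := by
  have e : alt (φ.neg.neg.imp φ) = (alt φ).image perp ∪ alt φ := by
    -- `alt` treats conclusions `⊥` separately; here φ begins with `∃`, so the general clause
    -- applies.
    have h₁ : alt (φ.neg.neg.imp φ) = (alt φ.neg.neg).image perp ∪ alt φ := by
      obtain ⟨ψ, rfl, -⟩ := mem_sigmaClass_succ.1 h
      simp [alt]
    rw [h₁, alt_neg, alt_neg, Finset.image_image, Finset.image_image]
    simp [Function.comp_def, perp_perp]
  have hp := (alt_prenex (j + 1) φ).1 h
  have hd : ∀ s ∈ alt φ, ∃ l, s = true :: l ∧ l.length = j := by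
    intro s hs
    obtain ⟨h₁, h₂⟩ := hp s hs
    match s with
    | [] => simp at h₁
    | false :: l => simp at h₂
    | true :: l => exact ⟨l, rfl, by simpa using h₁⟩
  have hall : ∀ s ∈ alt (φ.neg.neg.imp φ).all, s.head? = some false ∧ s.length ≤ j + 2 := by
    intro s hs
    rw [alt, e] at hs
    obtain ⟨t, ht, rfl⟩ := Finset.mem_image.1 hs
    refine ⟨head?_pushSign _ _, ?_⟩
    have : t.length = j + 1 := by
      rcases Finset.mem_union.1 ht with ht | ht
      · obtain ⟨r, hr, rfl⟩ := Finset.mem_image.1 ht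
        rw [length_perp, (hp r hr).1]
      · exact (hp t ht).1
    unfold pushSign
    split_ifs <;> simp [this]
  refine ⟨le_antisymm (Finset.sup_le fun s hs => (hall s hs).2) ?_, fun s hs _ => (hall s hs).1⟩
  obtain ⟨s, hs⟩ := alt_nonempty φ
  obtain ⟨l, rfl, hl⟩ := hd s hs
  have hm : false :: true :: l ∈ alt (φ.neg.neg.imp φ).all := by
    rw [alt, e]
    exact Finset.mem_image.2 ⟨_, Finset.mem_union_right _ hs, by simp [pushSign]⟩
  calc j + 2 = (false :: true :: l).length := by simp [hl]
    _ ≤ _ := Finset.le_sup (f := List.length) hm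

theorem neg_mem_EClass {j : ℕ} {φ : Fml} (h : φ ∈ UClass j) : φ.neg ∈ EClass j := by
  have hdeg : degree φ.neg = degree φ := by
    simp [degree, alt_neg, Finset.sup_image, Function.comp_def]
  cases j with
  | zero => exact hdeg.trans h
  | succ j =>
    refine ⟨hdeg.trans h.1, fun s hs hl => ?_⟩
    rw [alt_neg] at hs
    obtain ⟨t, ht, rfl⟩ := Finset.mem_image.1 hs
    rw [head?_perp, h.2 t ht (by simpa using hl)]
    rfl

/-! ### The equivalences -/

theorem PNFT_of_DNE {T : Set Fml} (hT : IsExtension T HA) {m : ℕ}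
    (h : ProvesSchema T (dnClass (DNE (SigmaClass m)))) {j : ℕ} (hj : j ≤ m + 1) :
    PNFT T (dfClass (negClass (EClass j))) (dnClass (PiClass j)) := by
  rintro _ ⟨⟨φ, hφ, rfl⟩, hdf⟩
  have hc : ∀ A ∈ DNE (SigmaClass m), A.fv = ∅ := fun A => fv_eq_empty_of_mem_DNE
  have hS := arithTheory_union hc
  -- The prenex form is found in `HA` plus the `Σ_m-DNE` sentences, a substitution-closed theory;
  -- `T` proves these sentences only under `¬¬`.
  obtain ⟨ψ, hψ, hfv, e⟩ := rep_neg_of_mem_EClass hS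
    (fun φ => stable_of_DNE hS Set.subset_union_right) hdf.1 hj hφ
  have hdn := proves_dn_of_proves hT hc (fun A hA => h _ ⟨A, hA, rfl⟩) e.proves_iff
  -- `¬¬(¬φ ↔ ψ)` suffices because both sides of `¬φ ↔ ¬¬ψ` are negations: the goals can be reduced
  -- to `⊥`, where double negations may be dropped.
  refine ⟨_, ⟨ψ, hψ, rfl⟩, by simpa using hfv, .andI (.impI ?_) (.impI (.negI ?_))⟩
  · exact hdn.wk.dn_map (.impE (Derives.andEl .hyp0) .hyp1)
  · refine hdn.wk.wk.dnE (Derives.hyp2.dnE (.impE (.impE (Derives.andEr .hyp1) .hyp0) ?_))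
    exact .hyp (by simp)

theorem PNFT.mono_left {T Γ Γ' Δ : Set Fml} (h : PNFT T Γ Δ) (hs : Γ' ⊆ Γ) : PNFT T Γ' Δ :=
  fun φ hφ => h φ (hs hφ)

theorem dfClass_dnClass_UClass_subset (j : ℕ) :
    dfClass (dnClass (UClass j)) ⊆ dfClass (negClass (EClass j)) := by
  rintro _ ⟨⟨φ, hφ, rfl⟩, hdf⟩
  exact ⟨⟨φ.neg, neg_mem_EClass hφ, rfl⟩, hdf⟩

theorem HA_proves_DNE_zero {A : Fml} (hA : A ∈ DNE (SigmaClass 0)) : Proves HA A := by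
  obtain ⟨φ, hφ, -, rfl⟩ := hA
  refine .allI (.impI (Dec.stable (fun Γ => ?_) _ .hyp0))
  exact arithTheory_HA.qf_em (mem_sigmaClass_zero.1 hφ)

theorem PA_proves_dne (φ : Fml) : Proves PA (φ.neg.neg.imp φ).all := by
  refine .allI (.impI (Dec.stable (fun Γ => ?_) _ .hyp0))
  exact .ax (.inr ⟨φ, rfl⟩)

/-- The step from `Σ_a-DNE` to `Σ_{a+1}-DNE`, in doubly negated form. -/
theorem DNE_succ_of_PNFT {T : Set Fml} {a b : ℕ} (hab : a ≤ b) (hT : IsExtension T HA)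
    (hPA : IsExtension PA T) (hL : ProvesSchema T (dnClass (LEM (PiClass b))))
    (hD : ProvesSchema T (dnClass (DNE (SigmaClass a))))
    (h : PNFT T (dfClass (dnClass (UClass (a + 2)))) (dnClass (PiClass (a + 2)))) :
    ProvesSchema T (dnClass (DNE (SigmaClass (a + 1)))) := by
  rintro _ ⟨_, ⟨φ, hφ, hfv, rfl⟩, rfl⟩
  have hc : ∀ A ∈ LEM (PiClass b) ∪ DNE (SigmaClass a), A.fv = ∅ := fun A hA =>
    hA.elim fv_eq_empty_of_mem_LEM fv_eq_empty_of_mem_DNE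
  have hS := arithTheory_union hc
  have hD' : ∀ φ, RSig _ a φ → Stable _ φ := fun φ => stable_of_DNE hS
    (Set.subset_union_right.trans Set.subset_union_right)
  have hL' : ∀ φ, RPi _ a φ → Dec _ φ := fun φ hφ => dec_of_LEM hS
    (Set.subset_union_left.trans Set.subset_union_right) (RPi.mono hS hab hφ)
  obtain ⟨hφ', e⟩ := (prenex_orElim arithTheory_HA (a + 1) φ).1 hφ
  obtain ⟨_, ⟨π, hπ, rfl⟩, -, hiff⟩ := h (φ.orElim.neg.neg.imp φ.orElim).all.neg.neg
    ⟨⟨_, dne_mem_UClass hφ', rfl⟩,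
      ⟨⟨⟨⟨φ.orElim_orFree, trivial⟩, trivial⟩, φ.orElim_orFree⟩, trivial⟩, trivial⟩
  have h₁ : Proves PA π := by
    have d : Proves PA π.neg.neg := .impE (Derives.andEl (hPA _ hiff)) (.dnI (PA_proves_dne _))
    exact Dec.stable (fun Γ => .ax (.inr ⟨π, rfl⟩)) _ d
  -- By conservation π follows from `Π_a-LEM` and `Σ_a-DNE` over `HA`. `T` has these axioms doubly
  -- negated, which is enough for `¬¬π`.
  have h₂ : Proves T π.neg.neg := by
    refine proves_dn_of_proves hT hc ?_ (proves_pi_of_PA hS hD' hL' hπ h₁)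
    rintro A (hA | hA)
    · exact hL _ ⟨A, hA, rfl⟩
    · exact hD _ ⟨A, hA, rfl⟩
  have h₃ := Derives.impE (Derives.andEr hiff) h₂
  have e' : Eqv HA (φ.neg.neg.imp φ).all.neg.neg (φ.orElim.neg.neg.imp φ.orElim).all.neg.neg :=
    (((e.neg.neg.imp e).all HA_substClosed).neg).neg
  exact .impE (Derives.andEr (hT _ e'.proves_iff)) h₃

theorem isExtension_HA {T : Set Fml} {k : ℕ}
    (h : IsExtension T (if k < 2 then HA else HA ∪ dnClass (LEM (PiClass (k - 2))))) :
    IsExtension T HA := by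
  split_ifs at h
  · exact h
  · exact fun φ hφ => h φ (Derives.mono hφ Set.subset_union_left)

theorem DNE_of_PNFT {T : Set Fml} {k : ℕ}
    (hHA : IsExtension T (if k < 2 then HA else HA ∪ dnClass (LEM (PiClass (k - 2)))))
    (hPA : IsExtension PA T)
    (h : ∀ j ≤ k, PNFT T (dfClass (dnClass (UClass j))) (dnClass (PiClass j))) {i : ℕ}
    (hi : i + 1 ≤ k) : ProvesSchema T (dnClass (DNE (SigmaClass i))) := by
  have hT := isExtension_HA hHA
  induction i with
  | zero =>
    rintro _ ⟨A, hA, rfl⟩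
    exact .dnI (hT _ (HA_proves_DNE_zero hA))
  | succ i ih =>
    rw [if_neg (by omega)] at hHA
    -- Here i + 2 ≤ k, so the available `¬¬Π_{k-2}-LEM` covers level i.
    exact DNE_succ_of_PNFT (a := i) (b := k - 2) (by omega) hT hPA
      (fun A hA => hHA A (.ax (.inr hA))) (ih (by omega)) (h _ hi)

end HeytingArith

open HeytingArith
theorem mainTheorem11 (k : ℕ) (T : Set Fml)
    (hHA : IsExtension T (if k < 2 then HA else HA ∪ dnClass (LEM (PiClass (k - 2)))))
    (hPA : IsExtension PA T) :
    List.TFAE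
      [ ∀ j ≤ k, PNFT T (dfClass (negClass (EClass j))) (dnClass (PiClass j)),
        ∀ j ≤ k, PNFT T (dfClass (dnClass (UClass j))) (dnClass (PiClass j)),
        0 < k → ProvesSchema T (dnClass (DNE (SigmaClass (k - 1)))) ] := by
  have hT := isExtension_HA hHA
  tfae_have 1 → 2 := fun h j hj => (h j hj).mono_left (dfClass_dnClass_UClass_subset j)
  tfae_have 2 → 3 := fun h hk => DNE_of_PNFT hHA hPA h (by omega)
  tfae_have 3 → 1 := by
    intro h j hj
    refine PNFT_of_DNE hT (m := k - 1) ?_ (by omega)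
    -- For k = 0 the truncated k - 1 is 0, and `Σ_0-DNE` is a theorem of `HA`.
    rcases k.eq_zero_or_pos with rfl | hk
    · rintro _ ⟨A, hA, rfl⟩
      exact .dnI (hT _ (HA_proves_DNE_zero hA))
    · exact h hk
  tfae_finish
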